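/- Let $H$ be a complex Hilbert space and let $E,A\in L(H)$ be such that the pair $(E,A)$ is regular, that is, there are $\nu\in\mathbb{R}$, $C\ge 0$ and $k\in\mathbb{N}$ such that for every $s\in\mathbb{C}$ with $\operatorname{Re}s>\nu$ the operator $sE+A$ is boundedly invertible and $\|(sE+A)^{-1}\|\le C|s|^{k}$. These conditions then hold for all sufficiently large $\nu$. Fix any $\nu>0$ for which they hold (with some $C$ and $k$), let $\operatorname{ind}(E,A)$ be the smallest $k\in\mathbb{N}$ that is possible for this $\nu$, and let $k\ge\operatorname{ind}(E,A)$ (for instance $k=\operatorname{ind}(E,A)$). Let $L_{2,\nu}(\mathbb{R};H)$ be the space of (classes of) measurable $f:\mathbb{R}\to H$ with $\int_{\mathbb{R}}\|f(t)\|^{2}e^{-2\nu t}\,dt<\infty$, and let $\partial_{0,\nu}$ be the weak derivative in $L_{2,\nu}(\mathbb{R};H)$ with maximal domain; it is boundedly invertible. For $j\in\mathbb{N}$ let $H_{\nu}^{-j}(\mathbb{R};H)$ be the completion of $L_{2,\nu}(\mathbb{R};H)$ with respect to the norm $\|\varphi\|_{-j}=\|\partial_{0,\nu}^{-j}\varphi\|$,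 so that $L_{2,\nu}(\mathbb{R};H)\hookrightarrow H_\nu^{-j}(\mathbb{R};H)\hookrightarrow H_\nu^{-j-1}(\mathbb{R};H)$. The pointwise actions of $E$ and $A$ are extended by continuity to $H_\nu^{-j}(\mathbb{R};H)$, $\partial_{0,\nu}$ to an operator $H_\nu^{-j}(\mathbb{R};H)\to H_\nu^{-j-1}(\mathbb{R};H)$, and $\partial_{0,\nu}^{-j}$ to an operator $H_\nu^{-j}(\mathbb{R};H)\to L_{2,\nu}(\mathbb{R};H)$. For $x\in H$ let $\delta\cdot x:=\partial_{0,\nu}(\chi_{\mathbb{R}_{\ge0}}x)\in H_\nu^{-1}(\mathbb{R};H)$. Then for every $f\in L_{2,\nu}(\mathbb{R};H)$ there is exactly one $w\in H_\nu^{-k}(\mathbb{R};H)$ with $(\partial_{0,\nu}E+A)w=f$ in $H_\nu^{-k-1}(\mathbb{R};H)$; it is denoted by $(\partial_{0,\nu}E+A)^{-1}f$, and $(\partial_{0,\nu}E+A)^{-1}:L_{2,\nu}(\mathbb{R};H)\to H_\nu^{-k}(\mathbb{R};H)$ is linear and bounded. Moreover, for every $u_0\in H$ there is a unique $u\in H_\nu^{-k}(\mathbb{R};H)$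 such that $$(\partial_{0,\nu}E+A)u=\delta\cdot Eu_0\quad\text{in }H_\nu^{-k-1}(\mathbb{R};H).$$ It is given by $$u=\chi_{\mathbb{R}_{\ge0}}u_0-(\partial_{0,\nu}E+A)^{-1}\chi_{\mathbb{R}_{\ge0}}Au_0,$$ and the function $\partial_{0,\nu}^{-k}u\in L_{2,\nu}(\mathbb{R};H)$ is supported in $[0,\infty)$. -/

import Mathlib

noncomputable section

namespace DAE

open MeasureTheory Set Filter Topology
open scoped ENNReal ContDiff

set_option linter.unusedSectionVars false

/-- The measure `exp (-2 ν t) dt` on the real line. -/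
def weight (ν : ℝ) : Measure ℝ :=
  volume.withDensity fun t => ENNReal.ofReal (Real.exp (-2 * ν * t))

lemma lintegral_weight (ν : ℝ) (f : ℝ → ℝ≥0∞) :
    ∫⁻ t, f t ∂(weight ν) = ∫⁻ t, ENNReal.ofReal (Real.exp (-2 * ν * t)) * f t := by
  rw [weight, lintegral_withDensity_eq_lintegral_mul_non_measurable]
  · rfl
  · fun_prop
  · exact ae_of_all _ fun t => ENNReal.ofReal_lt_top

lemma weight_ac (ν : ℝ) : weight ν ≪ volume := withDensity_absolutelyContinuous _ _

lemma ac_weight (ν : ℝ) : volume ≪ weight ν := by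
  refine withDensity_absolutelyContinuous' (by fun_prop) (ae_of_all _ fun t => ?_)
  simpa using Real.exp_pos _

instance (ν : ℝ) : IsLocallyFiniteMeasure (weight ν) :=
  IsLocallyFiniteMeasure.withDensity_ofReal (by fun_prop)

lemma lintegral_Iic_exp {ν : ℝ} (hν : 0 < ν) (t : ℝ) :
    ∫⁻ s in Iic t, ENNReal.ofReal (Real.exp (ν * s)) = ENNReal.ofReal (Real.exp (ν * t) / ν) := by
  rw [← integral_exp_mul_Iic hν, ofReal_integral_eq_lintegral_ofReal
    (integrableOn_exp_mul_Iic hν t) (ae_of_all _ fun s => (Real.exp_pos _).le)]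

lemma lintegral_Ici_exp {ν : ℝ} (hν : 0 < ν) (s : ℝ) :
    ∫⁻ t in Ici s, ENNReal.ofReal (Real.exp (-ν * t)) = ENNReal.ofReal (Real.exp (-ν * s) / ν) := by
  have h := integral_exp_mul_Ioi (neg_lt_zero.2 hν) s
  rw [setLIntegral_congr Ioi_ae_eq_Ici.symm, ← ofReal_integral_eq_lintegral_ofReal
    (integrableOn_exp_mul_Ioi (neg_lt_zero.2 hν) s) (ae_of_all _ fun s => (Real.exp_pos _).le), h]
  congr 1
  field_simp

lemma weight_Ici_ne_top {ν : ℝ} (hν : 0 < ν) : weight ν (Ici 0) ≠ ⊤ := by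
  have h := lintegral_Ici_exp (mul_pos two_pos hν) 0
  rw [weight, withDensity_apply _ measurableSet_Ici]
  simp only [neg_mul] at h ⊢
  rw [h]
  exact ENNReal.ofReal_ne_top

lemma hardy_aux {ν : ℝ} (hν : 0 < ν) {h : ℝ → ℝ≥0∞} (hh : AEMeasurable h) (t : ℝ) :
    (∫⁻ s in Iic t, h s) ^ (2 : ℝ) ≤ ENNReal.ofReal (Real.exp (ν * t) / ν) *
      ∫⁻ s in Iic t, ENNReal.ofReal (Real.exp (-ν * s)) * h s ^ (2 : ℝ) := by
  have cs := ENNReal.lintegral_mul_le_Lp_mul_Lq (volume.restrict (Iic t))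
    (Real.HolderConjugate.two_two) (f := fun s => ENNReal.ofReal (Real.exp (ν * s / 2)))
    (g := fun s => ENNReal.ofReal (Real.exp (-ν * s / 2)) * h s)
    (by fun_prop) (by fun_prop)
  have e1 : ∀ s, ENNReal.ofReal (Real.exp (ν * s / 2)) ^ (2 : ℝ)
      = ENNReal.ofReal (Real.exp (ν * s)) := fun s => by
    rw [ENNReal.ofReal_rpow_of_pos (Real.exp_pos _), ← Real.exp_mul]; ring_nf
  have e2 : ∀ s, (ENNReal.ofReal (Real.exp (-ν * s / 2)) * h s) ^ (2 : ℝ)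
      = ENNReal.ofReal (Real.exp (-ν * s)) * h s ^ (2 : ℝ) := fun s => by
    rw [ENNReal.mul_rpow_of_nonneg _ _ two_pos.le,
      ENNReal.ofReal_rpow_of_pos (Real.exp_pos _), ← Real.exp_mul]; ring_nf
  have e3 : ∀ s, ((fun s => ENNReal.ofReal (Real.exp (ν * s / 2))) *
      (fun s => ENNReal.ofReal (Real.exp (-ν * s / 2)) * h s)) s = h s := fun s => by
    simp only [Pi.mul_apply]
    rw [← mul_assoc, ← ENNReal.ofReal_mul (Real.exp_pos _).le, ← Real.exp_add]
    ring_nf; simp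
  simp only [e1, e2, e3, lintegral_Iic_exp hν] at cs
  calc _ ≤ _ := ENNReal.rpow_le_rpow cs two_pos.le
    _ = _ := by
      rw [ENNReal.mul_rpow_of_nonneg _ _ two_pos.le, ← ENNReal.rpow_mul, ← ENNReal.rpow_mul]
      norm_num

lemma hardy {ν : ℝ} (hν : 0 < ν) {h : ℝ → ℝ≥0∞} (hh : AEMeasurable h) :
    ∫⁻ t, (∫⁻ s in Iic t, h s) ^ (2 : ℝ) ∂(weight ν) ≤
      ENNReal.ofReal (ν⁻¹) ^ (2 : ℝ) * ∫⁻ t, h t ^ (2 : ℝ) ∂(weight ν) := by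
  rw [lintegral_weight, lintegral_weight]
  calc _ ≤ ∫⁻ t, ∫⁻ s, ENNReal.ofReal (ν⁻¹) * (if s ≤ t then ENNReal.ofReal (Real.exp (-ν * t)) else 0) *
        (ENNReal.ofReal (Real.exp (-ν * s)) * h s ^ (2 : ℝ)) := by
        refine lintegral_mono fun t => ?_
        refine (mul_le_mul_right (hardy_aux hν hh t) _).trans ?_
        rw [← mul_assoc, ← ENNReal.ofReal_mul (Real.exp_pos _).le, ← lintegral_indicator measurableSet_Iic,
          ← lintegral_const_mul' _ _ ENNReal.ofReal_ne_top]
        refine lintegral_mono fun s => ?_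
        by_cases hs : s ≤ t
        · simp only [indicator_of_mem (show s ∈ Iic t from hs), if_pos hs]
          rw [← ENNReal.ofReal_mul (inv_nonneg.2 hν.le)]
          refine le_of_eq (congrArg₂ _ (congrArg _ ?_) rfl)
          rw [mul_div_assoc', ← Real.exp_add, div_eq_inv_mul]
          ring_nf
        · simp [indicator_of_notMem (show s ∉ Iic t from hs), if_neg hs]
    _ = ∫⁻ s, ∫⁻ t, ENNReal.ofReal (ν⁻¹) * (if s ≤ t then ENNReal.ofReal (Real.exp (-ν * t)) else 0) *
        (ENNReal.ofReal (Real.exp (-ν * s)) * h s ^ (2 : ℝ)) := by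
        apply lintegral_lintegral_swap
        have h2 : AEMeasurable (fun p : ℝ × ℝ => h p.2) (volume.prod volume) :=
          hh.comp_quasiMeasurePreserving Measure.quasiMeasurePreserving_snd
        have h3 : Measurable (fun p : ℝ × ℝ =>
            if p.2 ≤ p.1 then ENNReal.ofReal (Real.exp (-ν * p.1)) else 0) :=
          Measurable.ite (measurableSet_le measurable_snd measurable_fst) (by fun_prop) (by fun_prop)
        unfold Function.uncurry
        have h4 := h3.aemeasurable (μ := (volume : Measure ℝ).prod volume)
        fun_prop
    _ ≤ ∫⁻ s, ENNReal.ofReal (ν⁻¹) ^ (2 : ℝ) * (ENNReal.ofReal (Real.exp (-2 * ν * s)) * h s ^ (2 : ℝ)) := by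
        refine lintegral_mono fun s => ?_
        have : ∀ t, (if s ≤ t then ENNReal.ofReal (Real.exp (-ν * t)) else 0)
          = (Ici s).indicator (fun t => ENNReal.ofReal (Real.exp (-ν * t))) t := fun t => by
            simp [indicator_apply]
        simp only [this]
        rw [lintegral_mul_const _ (by fun_prop (disch := measurability)), lintegral_const_mul _ (by fun_prop (disch := measurability)),
          lintegral_indicator measurableSet_Ici, lintegral_Ici_exp hν]
        rw [← mul_assoc, ← mul_assoc, ← ENNReal.ofReal_mul (by positivity), ← ENNReal.ofReal_mul (by positivity),
          ENNReal.ofReal_rpow_of_pos (by positivity), ← ENNReal.ofReal_mul (by positivity)]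
        refine le_of_eq (congrArg₂ _ (congrArg _ ?_) rfl)
        rw [Real.rpow_two, show -2 * ν * s = -ν * s + -ν * s by ring, Real.exp_add]
        field_simp
    _ = _ := by
        rw [lintegral_const_mul' _ _ (by simp)]

section

variable {H : Type*} [NormedAddCommGroup H] [InnerProductSpace ℂ H]

/-- The weighted space `L_{2,ν}(ℝ; H)`: classes of (strongly) measurable `f : ℝ → H` with
`∫ ‖f t‖² exp (-2 ν t) dt < ∞`. -/
abbrev L2w (ν : ℝ) (H : Type*) [NormedAddCommGroup H] : Type _ := Lp H 2 (weight ν)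

/-- `g` is the weak derivative of `f` on the real line (real-valued smooth compactly supported
test functions). -/
def IsWeakDeriv (f g : ℝ → H) : Prop :=
  ∀ φ : ℝ → ℝ, ContDiff ℝ ∞ φ → HasCompactSupport φ →
    ∫ t, deriv φ t • f t = -∫ t, φ t • g t

lemma aesm_volume {ν : ℝ} (f : L2w ν H) : AEStronglyMeasurable f volume :=
  (Lp.aestronglyMeasurable f).mono_ac (ac_weight ν)

lemma lintegral_sq_lt_top {ν : ℝ} (f : L2w ν H) :
    ∫⁻ t, ‖f t‖ₑ ^ (2 : ℝ) ∂(weight ν) < ⊤ := by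
  simpa using lintegral_rpow_enorm_lt_top_of_eLpNorm_lt_top (p := 2) (by simp) (by simp)
    (Lp.memLp f).2

lemma integrableOn_Iic {ν : ℝ} (hν : 0 < ν) (f : L2w ν H) (t : ℝ) :
    IntegrableOn f (Iic t) := by
  refine ⟨(aesm_volume f).restrict, ?_⟩
  have h := hardy_aux hν (aesm_volume f).enorm t
  have h2 : ∫⁻ s in Iic t, ENNReal.ofReal (Real.exp (-ν * s)) * ‖f s‖ₑ ^ (2 : ℝ)
      ≤ ENNReal.ofReal (Real.exp (ν * t)) * ∫⁻ t, ‖f t‖ₑ ^ (2 : ℝ) ∂(weight ν) := by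
    rw [lintegral_weight, ← lintegral_const_mul' _ _ ENNReal.ofReal_ne_top]
    refine le_trans ?_ (setLIntegral_le_lintegral (Iic t) _)
    refine setLIntegral_mono' measurableSet_Iic fun s hs => ?_
    rw [← mul_assoc, ← ENNReal.ofReal_mul (Real.exp_pos _).le, ← Real.exp_add]
    gcongr
    nlinarith [mem_Iic.1 hs]
  have h3 : (∫⁻ s in Iic t, ‖f s‖ₑ) ^ (2 : ℝ) < ⊤ :=
    h.trans_lt (ENNReal.mul_lt_top ENNReal.ofReal_lt_top
      (h2.trans_lt (ENNReal.mul_lt_top ENNReal.ofReal_lt_top (lintegral_sq_lt_top f))))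
  exact (ENNReal.rpow_lt_top_iff_of_pos two_pos).1 h3

lemma locallyIntegrable {ν : ℝ} (hν : 0 < ν) (f : L2w ν H) :
    LocallyIntegrable f volume := fun x =>
  ⟨Iic (x + 1), Iic_mem_nhds (by linarith), integrableOn_Iic hν f _⟩

/-- The antiderivative `t ↦ ∫_{-∞}^t f`. -/
def antideriv (f : ℝ → H) (t : ℝ) : H := ∫ s in Iic t, f s

lemma continuous_antideriv {ν : ℝ} (hν : 0 < ν) (f : L2w ν H) : Continuous (antideriv f) := by
  have h : antideriv f = fun t => antideriv f 0 + ∫ s in (0 : ℝ)..t, f s := by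
    ext t
    rw [← intervalIntegral.integral_Iic_sub_Iic (integrableOn_Iic hν f 0)
      (integrableOn_Iic hν f t)]
    simp [antideriv]
  rw [h]
  refine continuous_const.add (intervalIntegral.continuous_primitive (fun a b => ?_) 0)
  exact ((locallyIntegrable hν f).integrableOn_isCompact isCompact_uIcc).intervalIntegrable

lemma lintegral_antideriv_le {ν : ℝ} (hν : 0 < ν) (f : L2w ν H) :
    ∫⁻ t, ‖antideriv f t‖ₑ ^ (2 : ℝ) ∂(weight ν) ≤
      ENNReal.ofReal (ν⁻¹) ^ (2 : ℝ) * ∫⁻ t, ‖f t‖ₑ ^ (2 : ℝ) ∂(weight ν) := by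
  refine le_trans (lintegral_mono fun t => ?_) (hardy hν (aesm_volume f).enorm)
  gcongr
  exact enorm_integral_le_lintegral_enorm _

lemma eLpNorm_antideriv_le {ν : ℝ} (hν : 0 < ν) (f : L2w ν H) :
    eLpNorm (antideriv f) 2 (weight ν) ≤ ENNReal.ofReal (ν⁻¹) * eLpNorm f 2 (weight ν) := by
  have h := ENNReal.rpow_le_rpow (lintegral_antideriv_le hν f) (z := 1 / 2) (by norm_num)
  rw [ENNReal.mul_rpow_of_nonneg _ _ (by norm_num), ← ENNReal.rpow_mul] at h
  rw [eLpNorm_eq_lintegral_rpow_enorm_toReal (by simp) (by simp),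
    eLpNorm_eq_lintegral_rpow_enorm_toReal (by simp) (by simp)]
  simpa using h

lemma memLp_antideriv {ν : ℝ} (hν : 0 < ν) (f : L2w ν H) :
    MemLp (antideriv f) 2 (weight ν) :=
  ⟨(continuous_antideriv hν f).aestronglyMeasurable,
    (eLpNorm_antideriv_le hν f).trans_lt (ENNReal.mul_lt_top ENNReal.ofReal_lt_top (Lp.memLp f).2)⟩

lemma antideriv_congr {ν : ℝ} {f g : ℝ → H} (h : f =ᵐ[weight ν] g) : antideriv f = antideriv g := by
  ext t
  exact setIntegral_congr_ae measurableSet_Iic (((ac_weight ν).ae_eq h).mono fun s hs _ => hs)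

/-- The bounded operator `∂_{0,ν}⁻¹` on `L_{2,ν}(ℝ; H)` for `ν > 0`, which is
`f ↦ (t ↦ ∫_{-∞}^t f)`. That it is the inverse of the weak derivative is `timeDerivInv_eq_iff`. -/
def timeDerivInv (ν : ℝ) [hν : Fact (0 < ν)] : L2w ν H →L[ℂ] L2w ν H :=
  LinearMap.mkContinuous
    { toFun := fun f => (memLp_antideriv hν.out f).toLp
      map_add' := fun f g => by
        rw [← MemLp.toLp_add]
        refine MemLp.toLp_congr _ _ (Eventually.of_forall fun t => ?_)
        rw [antideriv_congr (Lp.coeFn_add f g)]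
        exact integral_add (integrableOn_Iic hν.out f t) (integrableOn_Iic hν.out g t)
      map_smul' := fun c f => by
        rw [RingHom.id_apply, ← MemLp.toLp_const_smul]
        refine MemLp.toLp_congr _ _ (Eventually.of_forall fun t => ?_)
        rw [antideriv_congr (Lp.coeFn_smul c f)]
        exact integral_smul c _ }
    ν⁻¹ fun f => by
      simp only [LinearMap.coe_mk, AddHom.coe_mk]
      rw [Lp.norm_toLp, Lp.norm_def]
      refine (ENNReal.toReal_mono (ENNReal.mul_ne_top ENNReal.ofReal_ne_top (Lp.memLp f).2.ne)
        (eLpNorm_antideriv_le hν.out f)).trans_eq ?_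
      rw [ENNReal.toReal_mul, ENNReal.toReal_ofReal (inv_nonneg.2 hν.out.le)]

lemma coeFn_timeDerivInv {ν : ℝ} [hν : Fact (0 < ν)] (f : L2w ν H) :
    timeDerivInv ν f =ᵐ[weight ν] antideriv f :=
  MemLp.coeFn_toLp (memLp_antideriv hν.out f)

lemma IsWeakDeriv.congr {f f' g g' : ℝ → H} (h : IsWeakDeriv f g)
    (hf : f =ᵐ[volume] f') (hg : g =ᵐ[volume] g') : IsWeakDeriv f' g' := by
  intro φ h1 h2
  have e1 : ∫ t, deriv φ t • f t = ∫ t, deriv φ t • f' t :=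
    integral_congr_ae (hf.mono fun t ht => congrArg (deriv φ t • ·) ht)
  have e2 : ∫ t, φ t • g t = ∫ t, φ t • g' t :=
    integral_congr_ae (hg.mono fun t ht => congrArg (φ t • ·) ht)
  rw [← e1, ← e2, h φ h1 h2]

lemma integral_Ici_deriv {φ : ℝ → ℝ} (h1 : ContDiff ℝ ∞ φ) (h2 : HasCompactSupport φ) (s : ℝ) :
    ∫ t in Ici s, deriv φ t = -φ s := by
  rw [integral_Ici_eq_integral_Ioi, integral_Ioi_of_hasDerivAt_of_tendsto' (m := 0)
    (f := φ) (fun x _ => (h1.differentiable (by simp)).differentiableAt.hasDerivAt)]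
  · simp
  · exact ((h1.continuous_deriv (by simp)).integrable_of_hasCompactSupport h2.deriv).integrableOn
  · exact (h2.is_zero_at_infty).mono_left atTop_le_cocompact

lemma isWeakDeriv_antideriv [CompleteSpace H] {ν : ℝ} (hν : 0 < ν) (f : L2w ν H) :
    IsWeakDeriv (antideriv f) f := by
  intro φ h1 h2
  obtain ⟨b, hb⟩ := h2.bddAbove
  have hb' : ∀ t, b < t → deriv φ t = 0 := fun t ht => by
    by_contra h
    exact absurd (hb (support_deriv_subset h)) (not_le.2 ht)
  have hint : Integrable (deriv φ) :=
    (h1.continuous_deriv (by simp)).integrable_of_hasCompactSupport h2.deriv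
  have hprod : Integrable (Function.uncurry fun t s : ℝ =>
      (Iic t).indicator (fun s => deriv φ t • f s) s) (volume.prod volume) := by
    have h3 : Integrable (fun p : ℝ × ℝ => deriv φ p.1 • (Iic b).indicator f p.2)
        (volume.prod volume) :=
      hint.smul_prod ((integrable_indicator_iff measurableSet_Iic).2 (integrableOn_Iic hν f b))
    have h4 : (Function.uncurry fun t s : ℝ => (Iic t).indicator (fun s => deriv φ t • f s) s)
        = {p : ℝ × ℝ | p.2 ≤ p.1}.indicator
          (fun p : ℝ × ℝ => deriv φ p.1 • (Iic b).indicator f p.2) := by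
      ext ⟨t, s⟩
      by_cases hst : s ≤ t
      · by_cases hsb : s ≤ b
        · simp [Function.uncurry, hst, hsb]
        · simp [Function.uncurry, hst, hsb, hb' t (by linarith)]
      · simp [Function.uncurry, hst]
    rw [h4]
    exact h3.indicator (measurableSet_le measurable_snd measurable_fst)
  calc ∫ t, deriv φ t • antideriv f t
      = ∫ t, ∫ s, (Iic t).indicator (fun s => deriv φ t • f s) s := by
        congr 1 with t
        rw [integral_indicator measurableSet_Iic, integral_smul]
        rfl
    _ = ∫ s, ∫ t, (Iic t).indicator (fun s => deriv φ t • f s) s := integral_integral_swap hprod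
    _ = ∫ s, -(φ s • f s) := by
        congr 1 with s
        have : ∀ t, (Iic t).indicator (fun s => deriv φ t • f s) s
            = (Ici s).indicator (fun t => deriv φ t • f s) t := fun t => by
          simp [indicator_apply]
        simp only [this]
        rw [integral_indicator measurableSet_Ici, integral_smul_const, integral_Ici_deriv h1 h2,
          neg_smul]
    _ = _ := integral_neg _

lemma IsWeakDeriv.eq_zero_of_zero {ν : ℝ} (hν : 0 < ν) [CompleteSpace H] (h : L2w ν H)
    (hh : IsWeakDeriv h (0 : ℝ → H)) : h = 0 := by
  have hz : ∀ φ : ℝ → ℝ, ContDiff ℝ ∞ φ → HasCompactSupport φ → ∫ t, deriv φ t • h t = 0 :=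
    fun φ h1 h2 => by simpa using hh φ h1 h2
  -- integrable test functions of mean zero
  have key : ∀ θ : ℝ → ℝ, ContDiff ℝ ∞ θ → HasCompactSupport θ → ∫ t, θ t = 0 →
      ∫ t, θ t • h t = 0 := by
    intro θ h1 h2 h3
    have hi : Integrable θ := h1.continuous.integrable_of_hasCompactSupport h2
    have hd : ∀ t, HasDerivAt (fun t => ∫ s in Iic t, θ s) (θ t) t := fun t => by
      have e : (fun t => ∫ s in Iic t, θ s)
          = fun t => (∫ s in Iic (0 : ℝ), θ s) + ∫ s in (0 : ℝ)..t, θ s := by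
        ext t
        rw [← intervalIntegral.integral_Iic_sub_Iic hi.integrableOn hi.integrableOn]
        ring
      rw [e]
      exact (intervalIntegral.integral_hasDerivAt_right (hi.intervalIntegrable)
        (h1.continuous.stronglyMeasurableAtFilter _ _) h1.continuous.continuousAt).const_add _
    have hd' : deriv (fun t => ∫ s in Iic t, θ s) = θ := funext fun t => (hd t).deriv
    have hc : ContDiff ℝ ∞ (fun t => ∫ s in Iic t, θ s) :=
      contDiff_infty_iff_deriv.2 ⟨fun t => (hd t).differentiableAt, by rw [hd']; exact h1⟩
    suffices hs : HasCompactSupport (fun t => ∫ s in Iic t, θ s) by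
      simpa only [hd'] using hz _ hc hs
    obtain ⟨a, ha⟩ := h2.bddBelow
    obtain ⟨b, hb⟩ := h2.bddAbove
    refine HasCompactSupport.intro (isCompact_Icc (a := a) (b := b)) fun t ht => ?_
    have hza : ∀ s, s < a → θ s = 0 := fun s hs => by
      by_contra hne
      exact absurd (ha (subset_tsupport _ hne)) (not_le.2 hs)
    have hzb : ∀ s, b < s → θ s = 0 := fun s hs => by
      by_contra hne
      exact absurd (hb (subset_tsupport _ hne)) (not_le.2 hs)
    by_cases hta : t < a
    · exact setIntegral_eq_zero_of_forall_eq_zero fun s hs => hza s (lt_of_le_of_lt hs hta)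
    · have htb : b < t := by
        by_contra hc
        exact ht ⟨not_lt.1 hta, not_lt.1 hc⟩
      rw [← h3]
      exact setIntegral_eq_integral_of_forall_compl_eq_zero
        fun s hs => hzb s (htb.trans (not_le.1 hs))
  obtain ⟨η, hη1, hη2, hη3⟩ : ∃ η : ℝ → ℝ, ContDiff ℝ ∞ η ∧ HasCompactSupport η ∧ ∫ t, η t = 1 :=
    let B : ContDiffBump (0 : ℝ) := default
    ⟨B.normed volume, B.contDiff_normed, B.hasCompactSupport_normed, B.integral_normed⟩
  have hlim : Tendsto (fun a : ℝ => ∫ t, η (t - a) • h t) atBot (𝓝 0) := by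
    obtain ⟨b, hb⟩ := hη2.bddAbove
    obtain ⟨C, hC⟩ := hη2.exists_bound_of_continuous hη1.continuous
    have hzb : ∀ s, b < s → η s = 0 := fun s hs => by
      by_contra hne
      exact absurd (hb (subset_tsupport _ hne)) (not_le.2 hs)
    have h0 : Tendsto (fun a : ℝ => C * ∫ t in Iic (a + b), ‖h t‖) atBot (𝓝 0) := by
      simpa using (tendsto_integral_Iic_zero (μ := volume) (f := fun t => ‖h t‖)
        (tendsto_atBot_add_const_right _ b tendsto_id)).const_mul C
    refine squeeze_zero_norm (fun a => ?_) h0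
    rw [← integral_const_mul, ← setIntegral_eq_integral_of_forall_compl_eq_zero (s := Iic (a + b))
      (fun t ht => by rw [hzb _ (by linarith [not_le.1 (mem_Iic.not.1 ht)]), zero_smul])]
    refine norm_integral_le_of_norm_le ((integrableOn_Iic hν h _).norm.const_mul C)
      (ae_of_all _ fun t => ?_)
    rw [norm_smul]
    exact mul_le_mul_of_nonneg_right (hC _) (norm_nonneg _)
  have hall : ∀ φ : ℝ → ℝ, ContDiff ℝ ∞ φ → HasCompactSupport φ → ∫ t, φ t • h t = 0 := by
    intro φ h1 h2
    have hli := locallyIntegrable hν h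
    have hηs : ∀ a : ℝ, HasCompactSupport fun t => η (t - a) := fun a =>
      hη2.comp_homeomorph (Homeomorph.subRight a)
    have hηc : ∀ a : ℝ, ContDiff ℝ ∞ fun t => η (t - a) := fun a =>
      hη1.comp (contDiff_id.sub contDiff_const)
    have e : ∀ a : ℝ, ∫ t, φ t • h t = (∫ t, φ t) • ∫ t, η (t - a) • h t := fun a => by
      have := key (fun t => φ t - (∫ t, φ t) * η (t - a)) (h1.sub (contDiff_const.mul (hηc a)))
        (h2.sub ((hηs a).mul_left)) (by
          rw [integral_sub (h1.continuous.integrable_of_hasCompactSupport h2)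
            (((hηc a).continuous.integrable_of_hasCompactSupport (hηs a)).const_mul _),
            integral_const_mul, integral_sub_right_eq_self η a, hη3]
          ring)
      simp only [sub_smul, mul_smul] at this
      have hI : Integrable fun t => (∫ t, φ t) • η (t - a) • h t :=
        (hli.integrable_smul_left_of_hasCompactSupport (hηc a).continuous (hηs a)).smul _
      rw [integral_sub (hli.integrable_smul_left_of_hasCompactSupport h1.continuous h2) hI,
        integral_smul, sub_eq_zero] at this
      exact this
    have h5 := hlim.const_smul (∫ t, φ t)
    simp only [← e, smul_zero] at h5
    exact tendsto_nhds_unique tendsto_const_nhds h5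
  have h6 := ae_eq_zero_of_integral_contDiff_smul_eq_zero (locallyIntegrable hν h) hall
  exact Lp.ext (EventuallyEq.trans ((weight_ac ν).ae_le h6)
    (Lp.coeFn_zero H 2 (weight ν)).symm)


lemma IsWeakDeriv.add {ν : ℝ} (hν : 0 < ν) {f g f' g' : L2w ν H}
    (h : IsWeakDeriv f f') (h' : IsWeakDeriv g g') :
    IsWeakDeriv (f + g : L2w ν H) (f' + g' : L2w ν H) := by
  refine IsWeakDeriv.congr (f := (⇑f + ⇑g : ℝ → H)) (g := (⇑f' + ⇑g' : ℝ → H)) (fun φ h1 h2 => ?_)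
    ((ac_weight ν).ae_le (Lp.coeFn_add f g).symm) ((ac_weight ν).ae_le (Lp.coeFn_add f' g').symm)
  have hd : Continuous (deriv φ) := h1.continuous_deriv (by simp)
  simp only [Pi.add_apply, smul_add]
  rw [integral_add
      ((locallyIntegrable hν f).integrable_smul_left_of_hasCompactSupport hd h2.deriv)
      ((locallyIntegrable hν g).integrable_smul_left_of_hasCompactSupport hd h2.deriv),
    integral_add
      ((locallyIntegrable hν f').integrable_smul_left_of_hasCompactSupport h1.continuous h2)
      ((locallyIntegrable hν g').integrable_smul_left_of_hasCompactSupport h1.continuous h2),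
    h φ h1 h2, h' φ h1 h2, neg_add]

lemma IsWeakDeriv.smul {ν : ℝ} (c : ℂ) {f f' : L2w ν H} (h : IsWeakDeriv f f') :
    IsWeakDeriv (c • f : L2w ν H) (c • f' : L2w ν H) := by
  refine IsWeakDeriv.congr (f := c • ⇑f) (g := c • ⇑f') (fun φ h1 h2 => ?_)
    ((ac_weight ν).ae_le (Lp.coeFn_smul c f).symm) ((ac_weight ν).ae_le (Lp.coeFn_smul c f').symm)
  simp only [Pi.smul_apply, smul_comm _ c]
  rw [integral_smul, integral_smul, h φ h1 h2, smul_neg]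

lemma isWeakDeriv_zero {ν : ℝ} : IsWeakDeriv (0 : L2w ν H) (0 : L2w ν H) := by
  simpa using (IsWeakDeriv.smul (ν := ν) (f := (0 : L2w ν H)) (f' := (0 : L2w ν H)) 0
    (IsWeakDeriv.congr (f := 0) (g := 0) (fun φ _ _ => by simp)
      ((ac_weight ν).ae_le (Lp.coeFn_zero H 2 (weight ν)).symm)
      ((ac_weight ν).ae_le (Lp.coeFn_zero H 2 (weight ν)).symm)))

variable [CompleteSpace H]

lemma IsWeakDeriv.unique {ν : ℝ} (hν : 0 < ν) {f g g' : L2w ν H}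
    (h : IsWeakDeriv f g) (h' : IsWeakDeriv f g') : g = g' := by
  refine Lp.ext ((weight_ac ν).ae_le (ae_eq_of_integral_contDiff_smul_eq
    (locallyIntegrable hν g) (locallyIntegrable hν g') fun φ h1 h2 => ?_))
  rw [← neg_inj, ← h φ h1 h2, ← h' φ h1 h2]

/-- The (unbounded) operator `∂_{0,ν}` in `L_{2,ν}(ℝ; H)`: its domain `H_ν^1(ℝ; H)` consists of the
functions having a weak derivative in `L_{2,ν}(ℝ; H)`, and it maps a function to that derivative. -/
def timeDeriv (ν : ℝ) [hν : Fact (0 < ν)] (H : Type*) [NormedAddCommGroup H]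
    [InnerProductSpace ℂ H] [CompleteSpace H] : L2w ν H →ₗ.[ℂ] L2w ν H where
  domain :=
    { carrier := {f | ∃ g : L2w ν H, IsWeakDeriv f g}
      add_mem' := fun ⟨f', h⟩ ⟨g', h'⟩ => ⟨f' + g', h.add hν.out h'⟩
      zero_mem' := ⟨0, isWeakDeriv_zero⟩
      smul_mem' := fun c _ ⟨f', h⟩ => ⟨c • f', h.smul c⟩ }
  toFun :=
    { toFun := fun f => f.2.choose
      map_add' := fun f g => IsWeakDeriv.unique hν.out (f + g).2.choose_spec
        (f.2.choose_spec.add hν.out g.2.choose_spec)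
      map_smul' := fun c f => IsWeakDeriv.unique hν.out (c • f).2.choose_spec
        (f.2.choose_spec.smul c) }

variable {ν : ℝ} [hν : Fact (0 < ν)]

lemma mem_timeDeriv_graph {f g : L2w ν H} : (f, g) ∈ (timeDeriv ν H).graph ↔ IsWeakDeriv f g := by
  rw [LinearPMap.mem_graph_iff]
  constructor
  · rintro ⟨⟨y, hy⟩, rfl, rfl⟩
    exact hy.choose_spec
  · exact fun h => ⟨⟨f, ⟨g, h⟩⟩, rfl, IsWeakDeriv.unique hν.out
      (Exists.choose_spec (p := fun g : L2w ν H => IsWeakDeriv f g) ⟨g, h⟩) h⟩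

/-- `timeDerivInv` is the inverse of the weak derivative operator: `∂⁻¹ g = f` if and only if
`f` lies in the domain of `∂` and `∂ f = g`. -/
lemma timeDerivInv_eq_iff {f g : L2w ν H} :
    timeDerivInv ν g = f ↔ (f, g) ∈ (timeDeriv ν H).graph := by
  rw [mem_timeDeriv_graph]
  have h0 : ∀ g : L2w ν H, IsWeakDeriv (timeDerivInv ν g) g := fun g =>
    (isWeakDeriv_antideriv hν.out g).congr
      ((ac_weight ν).ae_le (coeFn_timeDerivInv g).symm) EventuallyEq.rfl
  refine ⟨fun h => h ▸ h0 g, fun h => ?_⟩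
  have h1 := (h0 g).add hν.out (h.smul (-1))
  rw [neg_one_smul, neg_one_smul, add_neg_cancel] at h1
  have h2 : timeDerivInv ν g + -f = 0 := IsWeakDeriv.eq_zero_of_zero hν.out _
    (h1.congr EventuallyEq.rfl ((ac_weight ν).ae_le (Lp.coeFn_zero H 2 (weight ν))))
  exact add_neg_eq_zero.1 h2

lemma dense_timeDeriv_domain : Dense ((timeDeriv ν H).domain : Set (L2w ν H)) := by
  refine (MeasureTheory.Lp.dense_hasCompactSupport_contDiff (F := H) (μ := weight ν) (p := 2)
    (by simp)).mono ?_
  rintro f ⟨g, hfg, hs, hg⟩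
  have hd : Continuous (deriv g) := hg.continuous_deriv (by simp)
  have hm : MemLp (deriv g) 2 (weight ν) := hd.memLp_of_hasCompactSupport hs.deriv
  refine ⟨hm.toLp, IsWeakDeriv.congr (f := g) (g := deriv g) (fun φ h1 h2 => ?_)
    ((ac_weight ν).ae_le hfg.symm) ((ac_weight ν).ae_le hm.coeFn_toLp.symm)⟩
  have hd1 : Continuous (deriv φ) := h1.continuous_deriv (by simp)
  have := integral_bilinear_hasDerivAt_right_eq_neg_left_of_integrable
    (L := ContinuousLinearMap.lsmul ℝ ℝ (E := H)) (u := φ) (v := g) (u' := deriv φ) (v' := deriv g)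
    (fun x _ => (h1.differentiable (by simp)).differentiableAt.hasDerivAt)
    (fun x _ => (hg.differentiable (by simp)).differentiableAt.hasDerivAt)
    ((h1.continuous.smul hd).integrable_of_hasCompactSupport h2.smul_right)
    ((hd1.smul hg.continuous).integrable_of_hasCompactSupport h2.deriv.smul_right)
    ((h1.continuous.smul hg.continuous).integrable_of_hasCompactSupport h2.smul_right)
  simp only [ContinuousLinearMap.lsmul_apply] at this
  rw [this, neg_neg]

/-- The vector space `L_{2,ν}(ℝ; H)`, to be normed by `‖φ‖_{-k} = ‖∂_{0,ν}^{-k} φ‖`. -/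
def PreExtrap (ν : ℝ) (_k : ℕ) (H : Type*) [NormedAddCommGroup H] : Type _ := L2w ν H

instance (k : ℕ) : AddCommGroup (PreExtrap ν k H) := inferInstanceAs (AddCommGroup (L2w ν H))

instance (k : ℕ) : Module ℂ (PreExtrap ν k H) := inferInstanceAs (Module ℂ (L2w ν H))

/-- The linear map `∂_{0,ν}^{-k}` on `L_{2,ν}(ℝ; H)`. -/
def preExtrapPow (k : ℕ) : PreExtrap ν k H →ₗ[ℂ] L2w ν H :=
  ((timeDerivInv ν ^ k : L2w ν H →L[ℂ] L2w ν H) : L2w ν H →ₗ[ℂ] L2w ν H)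

/-- The norm `‖φ‖_{-k} = ‖∂_{0,ν}^{-k} φ‖`, that is, the norm of the scalar product
`⟨φ, ψ⟩_{-k} = ⟨∂_{0,ν}^{-k} φ, ∂_{0,ν}^{-k} ψ⟩`. -/
instance (k : ℕ) : SeminormedAddCommGroup (PreExtrap ν k H) :=
  SeminormedAddCommGroup.induced _ _ (preExtrapPow k)

instance (k : ℕ) : NormedSpace ℂ (PreExtrap ν k H) :=
  NormedSpace.induced ℂ _ _ (preExtrapPow k)

/-- The extrapolation space `H_ν^{-k}(ℝ; H)`: the completion of `L_{2,ν}(ℝ; H)` with respect to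
`‖·‖_{-k}`. -/
abbrev Extrap (ν : ℝ) [Fact (0 < ν)] (k : ℕ) (H : Type*) [NormedAddCommGroup H]
    [InnerProductSpace ℂ H] [CompleteSpace H] : Type _ :=
  UniformSpace.Completion (PreExtrap ν k H)

/-- The canonical embedding of `L_{2,ν}(ℝ; H)` into its completion `H_ν^{-k}(ℝ; H)`. -/
def toExtrap (ν : ℝ) [Fact (0 < ν)] (k : ℕ) : L2w ν H →ₗ[ℂ] Extrap ν k H :=
  (UniformSpace.Completion.toComplₗᵢ (𝕜 := ℂ) (E := PreExtrap ν k H)).toLinearMap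

lemma norm_toExtrap (k : ℕ) (f : L2w ν H) : ‖toExtrap ν k f‖ = ‖(timeDerivInv ν ^ k) f‖ :=
  UniformSpace.Completion.norm_coe (E := PreExtrap ν k H) f

lemma denseRange_toExtrap (k : ℕ) : DenseRange (toExtrap ν k : L2w ν H →ₗ[ℂ] Extrap ν k H) :=
  UniformSpace.Completion.denseRange_coe (α := PreExtrap ν k H)

lemma denseRange_toExtrap_domain (k : ℕ) :
    DenseRange (toExtrap ν k ∘ₗ (timeDeriv ν H).domain.subtype) := by
  have hc : Continuous (toExtrap ν k : L2w ν H →ₗ[ℂ] Extrap ν k H) :=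
    AddMonoidHomClass.continuous_of_bound _ ‖(timeDerivInv ν ^ k : L2w ν H →L[ℂ] L2w ν H)‖
      fun f => by rw [norm_toExtrap]; exact ContinuousLinearMap.le_opNorm _ _
  have h1 : DenseRange (timeDeriv ν H).domain.subtype := by
    simpa [DenseRange] using! dense_timeDeriv_domain (ν := ν) (H := H)
  exact (denseRange_toExtrap k).comp h1 hc

/-- The extension to `H_ν^{-k}(ℝ; H)`, by continuity, of the pointwise action
`φ ↦ (t ↦ B (φ t))` of `B ∈ L(H)` on `L_{2,ν}(ℝ; H)`; see `opExt_toExtrap`. -/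
def opExt (ν : ℝ) [Fact (0 < ν)] (k : ℕ) (B : H →L[ℂ] H) : Extrap ν k H →L[ℂ] Extrap ν k H :=
  (toExtrap ν k ∘ₗ (B.compLpL 2 (weight ν)).toLinearMap).extendOfNorm (toExtrap ν k)

/-- The canonical inclusion `H_ν^{-k}(ℝ; H) ↪ H_ν^{-l}(ℝ; H)` for `k ≤ l`, which is the extension
by continuity of the identity of `L_{2,ν}(ℝ; H)`; see `inclusion_toExtrap`. -/
def inclusion (ν : ℝ) [Fact (0 < ν)] {k l : ℕ} (_h : k ≤ l) : Extrap ν k H →L[ℂ] Extrap ν l H :=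
  (toExtrap ν l).extendOfNorm (toExtrap ν k)

/-- The extension by continuity of `∂_{0,ν}`, densely defined on `H_ν^1(ℝ; H)`, to an operator
`H_ν^{-k}(ℝ; H) → H_ν^{-k-1}(ℝ; H)`; see `timeDerivExt_toExtrap`. -/
def timeDerivExt (ν : ℝ) [Fact (0 < ν)] (k : ℕ) : Extrap ν k H →L[ℂ] Extrap ν (k + 1) H :=
  (toExtrap ν (k + 1) ∘ₗ (timeDeriv ν H).toFun).extendOfNorm
    (toExtrap ν k ∘ₗ (timeDeriv ν H).domain.subtype)

/-- The extension by continuity of `∂_{0,ν}^{-k}` to an operator `H_ν^{-k}(ℝ; H) → L_{2,ν}(ℝ; H)`;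
see `timeDerivInvPowExt_toExtrap`. -/
def timeDerivInvPowExt (ν : ℝ) [Fact (0 < ν)] (k : ℕ) : Extrap ν k H →L[ℂ] L2w ν H :=
  (timeDerivInv ν ^ k : L2w ν H →L[ℂ] L2w ν H).toLinearMap.extendOfNorm (toExtrap ν k)

lemma timeDerivInv_compLp (B : H →L[ℂ] H) (f : L2w ν H) :
    timeDerivInv ν (B.compLpL 2 (weight ν) f) = B.compLpL 2 (weight ν) (timeDerivInv ν f) := by
  refine Lp.ext ?_
  filter_upwards [coeFn_timeDerivInv (B.compLpL 2 (weight ν) f), coeFn_timeDerivInv f,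
    B.coeFn_compLpL (timeDerivInv ν f)] with t h1 h2 h3
  rw [h1, h3, h2, antideriv_congr (B.coeFn_compLpL f)]
  exact B.integral_comp_comm (integrableOn_Iic hν.out f t)

lemma timeDerivInv_pow_compLp (B : H →L[ℂ] H) (k : ℕ) (f : L2w ν H) :
    (timeDerivInv ν ^ k) (B.compLpL 2 (weight ν) f)
      = B.compLpL 2 (weight ν) ((timeDerivInv ν ^ k) f) := by
  induction k with
  | zero => rfl
  | succ k ih => rw [pow_succ', mul_apply_eq_comp, ih, timeDerivInv_compLp,
      mul_apply_eq_comp]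

lemma opExt_toExtrap (k : ℕ) (B : H →L[ℂ] H) (f : L2w ν H) :
    opExt ν k B (toExtrap ν k f) = toExtrap ν k (B.compLpL 2 (weight ν) f) := by
  refine LinearMap.extendOfNorm_eq (denseRange_toExtrap k) ⟨‖B.compLpL 2 (weight ν)‖, fun f => ?_⟩ f
  simp only [LinearMap.comp_apply, ContinuousLinearMap.coe_coe, norm_toExtrap]
  rw [timeDerivInv_pow_compLp]
  exact ContinuousLinearMap.le_opNorm _ _

lemma inclusion_toExtrap {k l : ℕ} (h : k ≤ l) (f : L2w ν H) :
    inclusion ν h (toExtrap ν k f) = toExtrap ν l f := by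
  refine LinearMap.extendOfNorm_eq (denseRange_toExtrap k)
    ⟨‖(timeDerivInv ν ^ (l - k) : L2w ν H →L[ℂ] L2w ν H)‖, fun f => ?_⟩ f
  rw [norm_toExtrap, norm_toExtrap, ← Nat.sub_add_cancel h, pow_add, mul_apply_eq_comp,
    Nat.add_sub_cancel]
  exact ContinuousLinearMap.le_opNorm _ _

lemma timeDerivExt_toExtrap (k : ℕ) (f : (timeDeriv ν H).domain) :
    timeDerivExt ν k (toExtrap ν k f) = toExtrap ν (k + 1) (timeDeriv ν H f) := by
  refine LinearMap.extendOfNorm_eq (denseRange_toExtrap_domain k) ⟨1, fun f => ?_⟩ f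
  simp only [LinearMap.comp_apply, norm_toExtrap, one_mul]
  rw [pow_succ, mul_apply_eq_comp]
  have := timeDerivInv_eq_iff.2 ((timeDeriv ν H).mem_graph f)
  exact (congrArg (fun g => ‖(timeDerivInv ν ^ k) g‖) this).le

lemma timeDerivInvPowExt_toExtrap (k : ℕ) (f : L2w ν H) :
    timeDerivInvPowExt ν k (toExtrap ν k f) = (timeDerivInv ν ^ k) f :=
  LinearMap.extendOfNorm_eq (denseRange_toExtrap k)
    ⟨1, fun f => by rw [norm_toExtrap, one_mul]; rfl⟩ f

/-- The operator `∂_{0,ν} E + A : H_ν^{-k}(ℝ; H) → H_ν^{-k-1}(ℝ; H)`. -/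
def pencil (ν : ℝ) [Fact (0 < ν)] (k : ℕ) (E A : H →L[ℂ] H) :
    Extrap ν k H →L[ℂ] Extrap ν (k + 1) H :=
  timeDerivExt ν k ∘L opExt ν k E + inclusion ν k.le_succ ∘L opExt ν k A

/-- The function `χ_{[0,∞)} x` in `L_{2,ν}(ℝ; H)`. -/
def step (ν : ℝ) [hν : Fact (0 < ν)] (x : H) : L2w ν H :=
  indicatorConstLp 2 measurableSet_Ici (weight_Ici_ne_top hν.out) x

/-- The distribution `δ · x`, as the element of `H_ν^{-1}(ℝ; H)` that is the derivative of
`χ_{[0,∞)} x`; see `integral_deriv_smul_step`. -/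
def diracMul (ν : ℝ) [Fact (0 < ν)] (x : H) : Extrap ν 1 H :=
  timeDerivExt ν 0 (toExtrap ν 0 (step ν x))

/-- Tested against `φ`, the derivative of `χ_{[0,∞)} x` gives the point evaluation `φ(0) x`. -/
lemma integral_deriv_smul_step (x : H) (φ : ℝ → ℝ) (h1 : ContDiff ℝ ∞ φ)
    (h2 : HasCompactSupport φ) : -∫ t, deriv φ t • step ν x t = φ 0 • x := by
  have h : (fun t => deriv φ t • step ν x t) =ᵐ[volume]
      (Ici 0).indicator fun t => deriv φ t • x := by
    refine (ac_weight ν).ae_le ?_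
    filter_upwards [indicatorConstLp_coeFn (p := 2) (hs := measurableSet_Ici)
      (hμs := weight_Ici_ne_top hν.out) (c := x)] with t ht
    rw [step, ht]
    by_cases h0 : t ∈ Ici (0 : ℝ) <;> simp [h0, indicator]
  rw [integral_congr_ae h, integral_indicator measurableSet_Ici, integral_smul_const,
    integral_Ici_deriv h1 h2, neg_smul, neg_neg]

end

section

variable {H : Type*} [NormedAddCommGroup H] [InnerProductSpace ℂ H]

/-- `ρ(E, A)`: the complex `s` for which `s E + A` is invertible in `L(H)`. -/
def resolventSet (E A : H →L[ℂ] H) : Set ℂ := {s | IsUnit (s • E + A)}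

/-- The estimate `‖(s E + A)⁻¹‖ ≤ C |s|^k` on the half-plane `Re s > ν`, for some `C ≥ 0`. -/
def HasResolventBound (E A : H →L[ℂ] H) (ν : ℝ) (k : ℕ) : Prop :=
  ∃ C : ℝ, 0 ≤ C ∧ ∀ s : ℂ, ν < s.re → ‖Ring.inverse (s • E + A)‖ ≤ C * ‖s‖ ^ k

/-- The two conditions for the regularity of the pair `(E, A)` hold with the number `ν`: the
half-plane `Re s > ν` lies in `ρ(E, A)`, and the resolvent estimate holds there for some `k`. -/
def IsRegularAt (E A : H →L[ℂ] H) (ν : ℝ) : Prop :=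
  {s : ℂ | ν < s.re} ⊆ resolventSet E A ∧ ∃ k, HasResolventBound E A ν k

/-- The pair `(E, A)` is regular. -/
def IsRegular (E A : H →L[ℂ] H) : Prop := ∃ ν : ℝ, IsRegularAt E A ν

/-- The index of `(E, A)`, with respect to the half-plane `Re s > ν`: the smallest `k` for which
the resolvent estimate holds there. -/
def index (E A : H →L[ℂ] H) (ν : ℝ) : ℕ := sInf {k | HasResolventBound E A ν k}

end

end DAE

end

noncomputable section

namespace DAE

open MeasureTheory Set Filter Topology
open scoped ENNReal ContDiff FourierTransform SchwartzMap

set_option linter.unusedSectionVars false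

/-! ### Reduction from the extrapolation spaces to `L_{2,ν}` -/

section

variable {H : Type*} [NormedAddCommGroup H] [InnerProductSpace ℂ H] [CompleteSpace H]
  {ν : ℝ} [hν : Fact (0 < ν)]

/-! Since the norm of `H_ν^{-j}` is the `L_{2,ν}` norm of `∂^{-j}`, the operator `∂^{-j}` is unitary
from `H_ν^{-j}` onto `L_{2,ν}`. Applying `∂^{-(k+1)}` to the equation `(∂E + A) w = f` and setting
`v = ∂^{-k} w` turns it into the equation `(E + ∂⁻¹A) v = ∂^{-(k+1)} f` between bounded operators on
`L_{2,ν}` (`timeDerivInvPowExt_pencil`).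

The Fourier-Laplace transform makes `∂⁻¹` multiplication by `s⁻¹` on the line `Re s = ν`
(`coeFn_laplace_timeDerivInv`), so `E + ∂⁻¹A` becomes multiplication by `s⁻¹ (sE + A)`. The
resolvent bound says exactly that the symbol `s^{-k} (sE + A)⁻¹` is bounded. The corresponding
operator `T` satisfies `(E + ∂⁻¹A) T = T (E + ∂⁻¹A) = ∂^{-(k+1)}`, and injectivity of the powers of
`∂⁻¹` gives existence and uniqueness of `w = ∂^k T f` (`exists_bounded_solution_operator`,
`exists_solution_operator`).

For the initial value, `(∂E + A)(χ u₀) = δ·Eu₀ + χ Au₀`, so subtracting the solution with right-hand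
side `χ Au₀` leaves `δ·Eu₀`.

For the support, `∂^{-k} u = ∂^{-k} χ u₀ - T χ Au₀`, and only the causality of `T` on step functions
is needed. The transform of `∂⁻¹ T χ x` is `s^{-k-2} (sE + A)⁻¹ x`, which is holomorphic and
`O(|s|⁻²)` on the half-plane. The inversion integral then converges absolutely, and for `t < 0` it
vanishes by Cauchy's theorem (`integral_vline_eq_zero`). Finally, a function whose antiderivative
vanishes on the negative half-line vanishes there itself (`ae_eq_zero_of_timeDerivInv`). -/

lemma denseRange_timeDerivInv : DenseRange (timeDerivInv ν : L2w ν H →L[ℂ] L2w ν H) := by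
  refine (dense_timeDeriv_domain (ν := ν) (H := H)).mono fun f hf => ?_
  exact ⟨timeDeriv ν H ⟨f, hf⟩, timeDerivInv_eq_iff.2 ((timeDeriv ν H).mem_graph ⟨f, hf⟩)⟩

/-- Used for surjectivity of `timeDerivInvPowEquiv`: the range of an isometry on a complete space is
closed, so density suffices. -/
lemma denseRange_timeDerivInv_pow (k : ℕ) :
    DenseRange (timeDerivInv ν ^ k : L2w ν H →L[ℂ] L2w ν H) := by
  induction k with
  | zero => exact Function.surjective_id.denseRange
  | succ k ih =>
    rw [pow_succ']
    exact denseRange_timeDerivInv.comp ih (timeDerivInv ν).continuous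

lemma injective_timeDerivInv :
    Function.Injective (timeDerivInv ν : L2w ν H →L[ℂ] L2w ν H) := fun f g h => by
  have hf := mem_timeDeriv_graph.1 (timeDerivInv_eq_iff.1 (rfl : timeDerivInv ν f = _))
  have hg := mem_timeDeriv_graph.1 (timeDerivInv_eq_iff.1 (rfl : timeDerivInv ν g = _))
  rw [h] at hf
  exact hf.unique hν.out hg

lemma injective_timeDerivInv_pow (k : ℕ) :
    Function.Injective (timeDerivInv ν ^ k : L2w ν H →L[ℂ] L2w ν H) := by
  induction k with
  | zero => exact Function.injective_id
  | succ k ih =>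
    rw [pow_succ']
    exact injective_timeDerivInv.comp ih

/-- Two continuous linear maps on `H_ν^{-k}(ℝ; H)` agree if they agree on `L_{2,ν}(ℝ; H)`. -/
lemma ext_toExtrap {F : Type*} [NormedAddCommGroup F] [NormedSpace ℂ F] {k : ℕ}
    {S T : Extrap ν k H →L[ℂ] F} (h : ∀ f, S (toExtrap ν k f) = T (toExtrap ν k f)) : S = T :=
  DFunLike.coe_injective ((denseRange_toExtrap k).equalizer S.continuous T.continuous (funext h))

lemma norm_timeDerivInvPowExt (k : ℕ) (w : Extrap ν k H) :
    ‖timeDerivInvPowExt ν k w‖ = ‖w‖ := by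
  refine (denseRange_toExtrap k).induction_on (p := fun w => ‖timeDerivInvPowExt ν k w‖ = ‖w‖) w
    (isClosed_eq (by fun_prop) (by fun_prop)) fun f => ?_
  rw [timeDerivInvPowExt_toExtrap, norm_toExtrap]

/-- The unitary operator `∂_{0,ν}^{-k} : H_ν^{-k}(ℝ; H) → L_{2,ν}(ℝ; H)`. -/
def timeDerivInvPowEquiv (ν : ℝ) [Fact (0 < ν)] (k : ℕ) (H : Type*)
    [NormedAddCommGroup H] [InnerProductSpace ℂ H] [CompleteSpace H] :
    Extrap ν k H ≃ₗᵢ[ℂ] L2w ν H :=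
  LinearIsometryEquiv.ofSurjective
    ⟨(timeDerivInvPowExt ν k).toLinearMap, norm_timeDerivInvPowExt k⟩ (by
      have hi : Isometry (timeDerivInvPowExt ν k : Extrap ν k H →L[ℂ] L2w ν H) :=
        AddMonoidHomClass.isometry_of_norm _ (norm_timeDerivInvPowExt k)
      have hd : DenseRange (timeDerivInvPowExt ν k : Extrap ν k H →L[ℂ] L2w ν H) :=
        (denseRange_timeDerivInv_pow k).mono (by
          rintro _ ⟨f, rfl⟩
          exact ⟨toExtrap ν k f, timeDerivInvPowExt_toExtrap k f⟩)
      exact range_eq_univ.1 (hi.isClosedEmbedding.isClosed_range.closure_eq ▸ hd.closure_range))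

lemma injective_timeDerivInvPowExt (k : ℕ) :
    Function.Injective (timeDerivInvPowExt ν k : Extrap ν k H →L[ℂ] L2w ν H) :=
  (timeDerivInvPowEquiv ν k H).injective

lemma timeDerivInvPowExt_opExt (k : ℕ) (B : H →L[ℂ] H) (w : Extrap ν k H) :
    timeDerivInvPowExt ν k (opExt ν k B w)
      = B.compLpL 2 (weight ν) (timeDerivInvPowExt ν k w) := by
  refine DFunLike.congr_fun (ext_toExtrap (S := timeDerivInvPowExt ν k ∘L opExt ν k B)
    (T := B.compLpL 2 (weight ν) ∘L timeDerivInvPowExt ν k) fun f => ?_) w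
  simp only [ContinuousLinearMap.comp_apply, opExt_toExtrap, timeDerivInvPowExt_toExtrap,
    timeDerivInv_pow_compLp]

lemma timeDerivInvPowExt_inclusion {k l : ℕ} (h : k ≤ l) (w : Extrap ν k H) :
    timeDerivInvPowExt ν l (inclusion ν h w)
      = (timeDerivInv ν ^ (l - k)) (timeDerivInvPowExt ν k w) := by
  refine DFunLike.congr_fun (ext_toExtrap (S := timeDerivInvPowExt ν l ∘L inclusion ν h)
    (T := (timeDerivInv ν ^ (l - k)) ∘L timeDerivInvPowExt ν k) fun f => ?_) w
  simp only [ContinuousLinearMap.comp_apply, inclusion_toExtrap, timeDerivInvPowExt_toExtrap]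
  rw [← mul_apply_eq_comp, ← pow_add, Nat.sub_add_cancel h]

/-- The extended derivative is explicit only on the domain of `∂`, so the density of that domain in
`H_ν^{-k}` is used instead of the density of `L_{2,ν}`. -/
lemma timeDerivInvPowExt_timeDerivExt (k : ℕ) (w : Extrap ν k H) :
    timeDerivInvPowExt ν (k + 1) (timeDerivExt ν k w) = timeDerivInvPowExt ν k w := by
  refine (denseRange_toExtrap_domain (ν := ν) (H := H) k).induction_on (p := fun w =>
    timeDerivInvPowExt ν (k + 1) (timeDerivExt ν k w) = timeDerivInvPowExt ν k w) w
    (isClosed_eq (by fun_prop) (by fun_prop)) fun f => ?_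
  simp only [LinearMap.comp_apply, Submodule.subtype_apply,
    timeDerivExt_toExtrap, timeDerivInvPowExt_toExtrap]
  rw [pow_succ, mul_apply_eq_comp, timeDerivInv_eq_iff.2 ((timeDeriv ν H).mem_graph f)]

/-- The bounded operator `E + ∂_{0,ν}⁻¹ A` on `L_{2,ν}(ℝ; H)`. -/
def boundedPencil (ν : ℝ) [Fact (0 < ν)] (E A : H →L[ℂ] H) : L2w ν H →L[ℂ] L2w ν H :=
  E.compLpL 2 (weight ν) + timeDerivInv ν ∘L A.compLpL 2 (weight ν)

/-- One of the `k + 1` antiderivatives cancels the derivative in front of `E`; in the other term it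
survives as the `∂⁻¹` in front of `A`. -/
lemma timeDerivInvPowExt_pencil (k : ℕ) (E A : H →L[ℂ] H) (w : Extrap ν k H) :
    timeDerivInvPowExt ν (k + 1) (pencil ν k E A w)
      = boundedPencil ν E A (timeDerivInvPowExt ν k w) := by
  simp only [pencil, boundedPencil, add_apply,
    ContinuousLinearMap.comp_apply, map_add, timeDerivInvPowExt_timeDerivExt,
    timeDerivInvPowExt_inclusion, timeDerivInvPowExt_opExt, Nat.add_sub_cancel_left, pow_one]

lemma compLpL_step (B : H →L[ℂ] H) (x : H) :
    B.compLpL 2 (weight ν) (step ν x) = step ν (B x) := by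
  refine Lp.ext ?_
  filter_upwards [B.coeFn_compLpL (step ν x), indicatorConstLp_coeFn (p := 2)
      (hs := measurableSet_Ici) (hμs := weight_Ici_ne_top hν.out) (c := x),
    indicatorConstLp_coeFn (p := 2)
      (hs := measurableSet_Ici) (hμs := weight_Ici_ne_top hν.out) (c := B x)] with t h1 h2 h3
  rw [h1, step, step, h2, h3]
  by_cases h0 : t ∈ Ici (0 : ℝ) <;> simp [h0, indicator]

/-- The Dirac term is one derivative of a step, so `k` of the `k + 1` antiderivatives remain. -/
lemma timeDerivInvPowExt_inclusion_diracMul (k : ℕ) (x : H) :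
    timeDerivInvPowExt ν (k + 1) (inclusion ν (Nat.le_add_left 1 k) (diracMul ν x))
      = (timeDerivInv ν ^ k) (step ν x) := by
  rw [timeDerivInvPowExt_inclusion, diracMul, timeDerivInvPowExt_timeDerivExt,
    timeDerivInvPowExt_toExtrap, Nat.add_sub_cancel, pow_zero, one_apply_eq_self]

lemma boundedPencil_pow_comm (E A : H →L[ℂ] H) (k : ℕ) (f : L2w ν H) :
    boundedPencil ν E A ((timeDerivInv ν ^ k) f) = (timeDerivInv ν ^ k) (boundedPencil ν E A f) := by
  simp only [boundedPencil, add_apply, ContinuousLinearMap.comp_apply, map_add,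
    ← timeDerivInv_pow_compLp]
  congr 1
  exact DFunLike.congr_fun (pow_mul_comm' (timeDerivInv ν) k).symm _

lemma step_ae_eq_zero (x : H) : ∀ᵐ t : ℝ, t < 0 → step ν x t = 0 := by
  refine (ac_weight ν).ae_le ?_
  filter_upwards [indicatorConstLp_coeFn (p := 2)
      (hs := measurableSet_Ici) (hμs := weight_Ici_ne_top hν.out) (c := x)] with t h1 h2
  rw [step, h1, indicator_of_notMem (by simpa using h2)]

/-- `∂_{0,ν}⁻¹` is causal. -/
lemma timeDerivInv_ae_eq_zero {f : L2w ν H} (hf : ∀ᵐ t : ℝ, t < 0 → f t = 0) :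
    ∀ᵐ t : ℝ, t < 0 → timeDerivInv ν f t = 0 := by
  filter_upwards [(ac_weight ν).ae_le (coeFn_timeDerivInv f)] with t h1 h2
  rw [h1, antideriv]
  refine setIntegral_eq_zero_of_ae_eq_zero ?_
  filter_upwards [hf] with s hs hst
  exact hs (lt_of_le_of_lt hst h2)

lemma timeDerivInv_pow_ae_eq_zero {f : L2w ν H} (hf : ∀ᵐ t : ℝ, t < 0 → f t = 0) (k : ℕ) :
    ∀ᵐ t : ℝ, t < 0 → (timeDerivInv ν ^ k) f t = 0 := by
  induction k with
  | zero => exact hf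
  | succ k ih =>
    rw [pow_succ', mul_apply_eq_comp]
    exact timeDerivInv_ae_eq_zero ih

/-- The solution theory in the extrapolation spaces, reduced to a bounded operator `T` on
`L_{2,ν}(ℝ; H)` with `T = ∂_{0,ν}^{-k} (∂_{0,ν} E + A)⁻¹`. -/
lemma exists_solution_operator {E A : H →L[ℂ] H} {k : ℕ} (T : L2w ν H →L[ℂ] L2w ν H)
    (hT : ∀ f, boundedPencil ν E A (T f) = (timeDerivInv ν ^ (k + 1)) f)
    (hT' : ∀ f, T (boundedPencil ν E A f) = (timeDerivInv ν ^ (k + 1)) f)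
    (hc : ∀ x, ∀ᵐ t : ℝ, t < 0 → T (step ν x) t = 0) :
    ∃ S : L2w ν H →L[ℂ] Extrap ν k H,
      (∀ (f : L2w ν H) (w : Extrap ν k H),
        pencil ν k E A w = toExtrap ν (k + 1) f ↔ w = S f) ∧
      ∀ u₀ : H,
        (∃! u : Extrap ν k H,
          pencil ν k E A u = inclusion ν (Nat.le_add_left 1 k) (diracMul ν (E u₀))) ∧
        ∀ u : Extrap ν k H,
          pencil ν k E A u = inclusion ν (Nat.le_add_left 1 k) (diracMul ν (E u₀)) →
          u = toExtrap ν k (step ν u₀) - S (step ν (A u₀)) ∧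
          ∀ᵐ t : ℝ, t < 0 → timeDerivInvPowExt ν k u t = 0 := by
  -- `T` is a left inverse up to the injective factor `∂^{-(k+1)}`.
  have hinj : Function.Injective (boundedPencil ν E A) := fun f g h =>
    injective_timeDerivInv_pow (k + 1) (by rw [← hT', ← hT', h])
  set J := timeDerivInvPowEquiv ν k H
  set S : L2w ν H →L[ℂ] Extrap ν k H := J.symm.toContinuousLinearEquiv.toContinuousLinearMap ∘L T
  have hS : ∀ f, timeDerivInvPowExt ν k (S f) = T f := fun f => J.apply_symm_apply (T f)
  have hpinj : Function.Injective (pencil ν k E A : Extrap ν k H →L[ℂ] _) := fun w w' h =>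
    injective_timeDerivInvPowExt k (hinj (by
      rw [← timeDerivInvPowExt_pencil, ← timeDerivInvPowExt_pencil, h]))
  have hpS : ∀ f, pencil ν k E A (S f) = toExtrap ν (k + 1) f := fun f =>
    injective_timeDerivInvPowExt (k + 1) (by
      rw [timeDerivInvPowExt_pencil, hS, hT, timeDerivInvPowExt_toExtrap])
  -- After `∂^{-k}` is pulled out, this is `(E + ∂⁻¹A) χu₀ - ∂⁻¹ χAu₀ = χEu₀`.
  have hu : ∀ u₀, pencil ν k E A (toExtrap ν k (step ν u₀) - S (step ν (A u₀)))
      = inclusion ν (Nat.le_add_left 1 k) (diracMul ν (E u₀)) := fun u₀ =>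
    injective_timeDerivInvPowExt (k + 1) (by
      rw [map_sub, map_sub, hpS, timeDerivInvPowExt_pencil, timeDerivInvPowExt_toExtrap,
        timeDerivInvPowExt_toExtrap, timeDerivInvPowExt_inclusion_diracMul,
        boundedPencil_pow_comm, pow_succ, mul_apply_eq_comp, ← map_sub]
      simp only [boundedPencil, add_apply, ContinuousLinearMap.comp_apply, compLpL_step,
        add_sub_cancel_right])
  refine ⟨S, fun f w => ⟨fun h => hpinj (h.trans (hpS f).symm), fun h => h ▸ hpS f⟩, fun u₀ =>
    ⟨⟨_, hu u₀, fun u h => hpinj (h.trans (hu u₀).symm)⟩, fun u h => ?_⟩⟩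
  have hu' := hpinj (h.trans (hu u₀).symm)
  refine ⟨hu', ?_⟩
  rw [hu', map_sub, hS, timeDerivInvPowExt_toExtrap]
  filter_upwards [timeDerivInv_pow_ae_eq_zero (step_ae_eq_zero (ν := ν) u₀) k, hc (A u₀),
    (ac_weight ν).ae_le (Lp.coeFn_sub ((timeDerivInv ν ^ k) (step ν u₀)) (T (step ν (A u₀))))]
    with t h1 h2 h3 h4
  rw [h3, Pi.sub_apply, h1 h4, h2 h4, sub_zero]

end

/-! ### The Fourier-Laplace transform as a unitary operator -/

section

variable {H : Type*} [NormedAddCommGroup H] [InnerProductSpace ℂ H] [CompleteSpace H]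

lemma integral_schwartz_fourier_smul (φ : 𝓢(ℝ, ℂ)) {f : ℝ → H} (hf : Integrable f) :
    ∫ t, (𝓕 φ) t • f t = ∫ t, φ t • 𝓕 f t := by
  have := VectorFourier.integral_fourierIntegral_smul_eq_flip (L := innerₗ ℝ) (μ := volume)
    (ν := volume) Real.continuous_fourierChar continuous_inner φ.integrable hf
  rw [flip_innerₗ] at this
  rw [SchwartzMap.fourier_coe]
  exact this

lemma integral_schwartz_fourierInv_smul (φ : 𝓢(ℝ, ℂ)) {f : ℝ → H} (hf : Integrable f) :
    ∫ t, (𝓕⁻ φ) t • f t = ∫ t, φ t • 𝓕⁻ f t := by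
  -- The inverse transform is the Fourier integral for the negated pairing.
  have := VectorFourier.integral_fourierIntegral_smul_eq_flip (L := -innerₗ ℝ) (μ := volume)
    (ν := volume) Real.continuous_fourierChar (continuous_inner (𝕜 := ℝ) (E := ℝ)).neg
    φ.integrable hf
  rw [show (-innerₗ ℝ).flip = -(innerₗ ℝ : ℝ →ₗ[ℝ] ℝ →ₗ[ℝ] ℝ) by
    ext; simp] at this
  rw [SchwartzMap.fourierInv_coe]
  exact this

lemma ae_eq_of_integral_schwartz_smul_eq {f g : ℝ → H} (hf : LocallyIntegrable f)
    (hg : LocallyIntegrable g) (h : ∀ φ : 𝓢(ℝ, ℂ), ∫ t, φ t • f t = ∫ t, φ t • g t) :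
    f =ᵐ[volume] g := by
  refine ae_eq_of_integral_contDiff_smul_eq hf hg fun φ h1 h2 => ?_
  have h3 : HasCompactSupport fun t => (φ t : ℂ) :=
    h2.comp_left (g := fun x : ℝ => (x : ℂ)) Complex.ofReal_zero
  have h4 : ContDiff ℝ ∞ fun t => (φ t : ℂ) := Complex.ofRealCLM.contDiff.comp h1
  simpa using h (h3.toSchwartzMap h4)

/-- On `L₁ ∩ L₂` the Fourier transform of `L₂` is given by the Fourier integral. -/
lemma coeFn_fourier_toLp {f : ℝ → H} (hf : MemLp f 2) (hf1 : Integrable f) :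
    ⇑(𝓕 hf.toLp : Lp H 2 (volume : Measure ℝ)) =ᵐ[volume] 𝓕 f := by
  refine ae_eq_of_integral_schwartz_smul_eq
    ((Lp.memLp (𝓕 hf.toLp)).locallyIntegrable (by norm_num)) ?_ fun φ => ?_
  · exact (VectorFourier.fourierIntegral_continuous Real.continuous_fourierChar
      continuous_inner hf1).locallyIntegrable
  -- The `L₂` transform agrees with that of tempered distributions, where it is moved onto the test
  -- function; for integrable `f` it can then be moved back onto `f` as an integral.
  · rw [← Lp.toTemperedDistribution_apply, ← Lp.fourier_toTemperedDistribution_eq,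
      TemperedDistribution.fourier_apply, Lp.toTemperedDistribution_apply,
      ← integral_schwartz_fourier_smul φ hf1]
    exact integral_congr_ae (hf.coeFn_toLp.mono fun t ht => by simp only [ht])

/-- On `L₁ ∩ L₂` the inverse Fourier transform of `L₂` is given by the Fourier integral. -/
lemma coeFn_fourierInv_toLp {f : ℝ → H} (hf : MemLp f 2) (hf1 : Integrable f) :
    ⇑(𝓕⁻ hf.toLp : Lp H 2 (volume : Measure ℝ)) =ᵐ[volume] 𝓕⁻ f := by
  refine ae_eq_of_integral_schwartz_smul_eq
    ((Lp.memLp (𝓕⁻ hf.toLp)).locallyIntegrable (by norm_num)) ?_ fun φ => ?_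
  · exact (VectorFourier.fourierIntegral_continuous (L := -innerₗ ℝ) Real.continuous_fourierChar
      (continuous_inner (𝕜 := ℝ) (E := ℝ)).neg hf1).locallyIntegrable
  · rw [← Lp.toTemperedDistribution_apply, ← Lp.fourierInv_toTemperedDistribution_eq,
      TemperedDistribution.fourierInv_apply, Lp.toTemperedDistribution_apply,
      ← integral_schwartz_fourierInv_smul φ hf1]
    exact integral_congr_ae (hf.coeFn_toLp.mono fun t ht => by simp only [ht])

/-! ### Multiplication by an exponential weight -/

/-- The density of `weight ν` is the square of `exp (-ν t)`. -/
lemma eLpNorm_exp_smul (ν : ℝ) (f : ℝ → H) :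
    eLpNorm (fun t => Real.exp (-ν * t) • f t) 2 volume = eLpNorm f 2 (weight ν) := by
  rw [eLpNorm_eq_lintegral_rpow_enorm_toReal (by simp) (by simp),
    eLpNorm_eq_lintegral_rpow_enorm_toReal (by simp) (by simp), lintegral_weight]
  congr 1
  refine lintegral_congr fun t => ?_
  rw [enorm_smul, ENNReal.mul_rpow_of_nonneg _ _ (by simp), Real.enorm_of_nonneg (Real.exp_pos _).le,
    ENNReal.ofReal_rpow_of_pos (Real.exp_pos _), ← Real.exp_mul]
  congr 3
  simp
  ring

lemma memLp_exp_smul {ν : ℝ} {f : ℝ → H} (hf : MemLp f 2 (weight ν)) :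
    MemLp (fun t => Real.exp (-ν * t) • f t) 2 volume :=
  ⟨(by fun_prop : Continuous fun t : ℝ => Real.exp (-ν * t)).aestronglyMeasurable.smul
    (hf.1.mono_ac (ac_weight ν)), by rw [eLpNorm_exp_smul]; exact hf.2⟩

lemma memLp_exp_smul' {ν : ℝ} {f : ℝ → H} (hf : MemLp f 2 volume) :
    MemLp (fun t => Real.exp (ν * t) • f t) 2 (weight ν) := by
  refine ⟨(by fun_prop : Continuous fun t : ℝ => Real.exp (ν * t)).aestronglyMeasurable.smul
    (hf.1.mono_ac (weight_ac ν)), ?_⟩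
  rw [← eLpNorm_exp_smul]
  simpa [← mul_smul, ← Real.exp_add] using hf.2

/-- The isometry `f ↦ (t ↦ exp (-ν t) f t)` from `L_{2,ν}(ℝ; H)` to `L_2(ℝ; H)`. -/
def expWeightIsometry (ν : ℝ) (H : Type*) [NormedAddCommGroup H] [InnerProductSpace ℂ H]
    [CompleteSpace H] : L2w ν H →ₗᵢ[ℂ] Lp H 2 (volume : Measure ℝ) where
  toFun := fun f => (memLp_exp_smul (Lp.memLp f)).toLp
  map_add' := fun f g => by
    rw [← MemLp.toLp_add]
    refine MemLp.toLp_congr _ _ ?_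
    filter_upwards [(ac_weight ν).ae_le (Lp.coeFn_add f g)] with t ht
    rw [ht, Pi.add_apply, Pi.add_apply, smul_add]
  map_smul' := fun c f => by
    rw [RingHom.id_apply, ← MemLp.toLp_const_smul]
    refine MemLp.toLp_congr _ _ ?_
    filter_upwards [(ac_weight ν).ae_le (Lp.coeFn_smul c f)] with t ht
    rw [ht, Pi.smul_apply, Pi.smul_apply, smul_comm]
  norm_map' := fun f => by
    change ‖(memLp_exp_smul (Lp.memLp f)).toLp‖ = _
    rw [Lp.norm_toLp, Lp.norm_def, eLpNorm_exp_smul]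

lemma coeFn_expWeightIsometry {ν : ℝ} (f : L2w ν H) :
    expWeightIsometry ν H f =ᵐ[volume] fun t => Real.exp (-ν * t) • f t :=
  (memLp_exp_smul (Lp.memLp f)).coeFn_toLp

lemma surjective_expWeightIsometry (ν : ℝ) : Function.Surjective (expWeightIsometry ν H) :=
  fun g => ⟨(memLp_exp_smul' (Lp.memLp g)).toLp, Lp.ext (by
    refine (coeFn_expWeightIsometry _).trans ?_
    filter_upwards [(ac_weight ν).ae_le (memLp_exp_smul' (ν := ν) (Lp.memLp g)).coeFn_toLp]
      with t ht
    rw [ht, ← mul_smul, ← Real.exp_add]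
    simp)⟩

/-- The unitary operator `f ↦ (t ↦ exp (-ν t) f t)` from `L_{2,ν}(ℝ; H)` to `L_2(ℝ; H)`. -/
def expWeight (ν : ℝ) (H : Type*) [NormedAddCommGroup H] [InnerProductSpace ℂ H]
    [CompleteSpace H] : L2w ν H ≃ₗᵢ[ℂ] Lp H 2 (volume : Measure ℝ) :=
  LinearIsometryEquiv.ofSurjective (expWeightIsometry ν H) (surjective_expWeightIsometry ν)

lemma coeFn_expWeight {ν : ℝ} (f : L2w ν H) :
    expWeight ν H f =ᵐ[volume] fun t => Real.exp (-ν * t) • f t :=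
  coeFn_expWeightIsometry f

/-- The Fourier-Laplace transform, a unitary operator from `L_{2,ν}(ℝ; H)` to `L_2(ℝ; H)`. -/
def laplace (ν : ℝ) (H : Type*) [NormedAddCommGroup H] [InnerProductSpace ℂ H] [CompleteSpace H] :
    L2w ν H ≃ₗᵢ[ℂ] Lp H 2 (volume : Measure ℝ) :=
  (expWeight ν H).trans (Lp.fourierTransformₗᵢ ℝ H)

/-- The point `ν + 2 π i ξ` on the line `Re s = ν`. -/
def vline (ν ξ : ℝ) : ℂ := ν + (2 * Real.pi * ξ : ℝ) * Complex.I

@[simp] lemma vline_re (ν ξ : ℝ) : (vline ν ξ).re = ν := by simp [vline]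

lemma continuous_vline (ν : ℝ) : Continuous (vline ν) := by unfold vline; fun_prop

/-- If `t ↦ exp (-ν t) f t` is integrable, the Fourier-Laplace transform of `f` is given by the
Laplace integral. -/
lemma coeFn_laplace {ν : ℝ} (f : L2w ν H) (hf : Integrable fun t => Real.exp (-ν * t) • f t) :
    laplace ν H f =ᵐ[volume] fun ξ => ∫ t : ℝ, Complex.exp (-vline ν ξ * t) • f t := by
  refine (coeFn_fourier_toLp (memLp_exp_smul (Lp.memLp f)) hf).trans
    (Eventually.of_forall fun ξ => ?_)
  simp only
  rw [Real.fourier_eq']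
  -- The weight `exp (-ν t)` and the kernel `exp (-2πi t ξ)` combine to `exp (-s t)` with `s = vline
  -- ν ξ`; the factor `2π` in `vline` matches this normalisation.
  congr 1 with t
  rw [← Complex.coe_smul, ← mul_smul, Complex.ofReal_exp, ← Complex.exp_add]
  congr 2
  simp [vline]
  ring

/-- If the Fourier-Laplace transform of `f` is integrable, `f` is given by an integral along
`Re s = ν`. -/
lemma ae_eq_of_laplace_ae_eq {ν : ℝ} (f : L2w ν H) {g : ℝ → H} (hg : Integrable g)
    (h : laplace ν H f =ᵐ[volume] g) :
    f =ᵐ[volume] fun t => ∫ ξ : ℝ, Complex.exp (vline ν ξ * t) • g ξ := by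
  have hg2 : MemLp g 2 := (memLp_congr_ae h).1 (Lp.memLp _)
  have h1 : 𝓕 (expWeight ν H f) = hg2.toLp :=
    Lp.ext (h.trans hg2.coeFn_toLp.symm)
  have h2 : expWeight ν H f = 𝓕⁻ hg2.toLp := by
    rw [← h1, FourierTransform.fourierInv_fourier_eq]
  filter_upwards [coeFn_expWeight f, coeFn_fourierInv_toLp hg2 hg] with t h3 h4
  rw [h2, h4] at h3
  have h5 : f t = Real.exp (ν * t) • Real.exp (-ν * t) • f t := by
    rw [← mul_smul, ← Real.exp_add]; simp
  rw [h5, ← h3, Real.fourierInv_eq', ← integral_smul]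
  congr 1 with ξ
  rw [← Complex.coe_smul, ← mul_smul, Complex.ofReal_exp, ← Complex.exp_add]
  congr 2
  simp [vline]
  ring

end

section

variable {H : Type*} [NormedAddCommGroup H] [InnerProductSpace ℂ H] [CompleteSpace H]

/-! ### Multiplication operators on `L_2` -/

lemma memLp_mul {M : ℝ → H →L[ℂ] H} (hM : Continuous M) {C : ℝ} (hC : ∀ ξ, ‖M ξ‖ ≤ C)
    {g : ℝ → H} (hg : MemLp g 2) : MemLp (fun ξ => M ξ (g ξ)) 2 :=
  hg.of_le_mul ((ContinuousLinearMap.id ℂ (H →L[ℂ] H)).aestronglyMeasurable_comp₂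
    hM.aestronglyMeasurable hg.1) (ae_of_all _ fun ξ => (M ξ).le_of_opNorm_le (hC ξ) (g ξ))

/-- Multiplication with a bounded continuous operator-valued function. -/
def mulOp (M : ℝ → H →L[ℂ] H) (hM : Continuous M) (C : ℝ) (hC : ∀ ξ, ‖M ξ‖ ≤ C) :
    Lp H 2 (volume : Measure ℝ) →L[ℂ] Lp H 2 (volume : Measure ℝ) :=
  LinearMap.mkContinuous
    { toFun := fun g => (memLp_mul hM hC (Lp.memLp g)).toLp
      map_add' := fun f g => by
        rw [← MemLp.toLp_add]
        refine MemLp.toLp_congr _ _ ?_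
        filter_upwards [Lp.coeFn_add f g] with t ht
        rw [ht, Pi.add_apply, Pi.add_apply, map_add]
      map_smul' := fun c f => by
        rw [RingHom.id_apply, ← MemLp.toLp_const_smul]
        refine MemLp.toLp_congr _ _ ?_
        filter_upwards [Lp.coeFn_smul c f] with t ht
        rw [ht, Pi.smul_apply, Pi.smul_apply, map_smul] }
    C fun g => by
      refine Lp.norm_le_mul_norm_of_ae_le_mul ?_
      filter_upwards [(memLp_mul hM hC (Lp.memLp g)).coeFn_toLp] with ξ h
      simp only [LinearMap.coe_mk, AddHom.coe_mk, h]
      exact (M ξ).le_of_opNorm_le (hC ξ) (g ξ)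

lemma coeFn_mulOp {M : ℝ → H →L[ℂ] H} (hM : Continuous M) {C : ℝ} (hC : ∀ ξ, ‖M ξ‖ ≤ C)
    (g : Lp H 2 (volume : Measure ℝ)) : mulOp M hM C hC g =ᵐ[volume] fun ξ => M ξ (g ξ) :=
  (memLp_mul hM hC (Lp.memLp g)).coeFn_toLp

/-! ### Rules for the Fourier-Laplace transform -/

variable {ν : ℝ}

/-- Continuous linear maps on `L_{2,ν}(ℝ; H)` agree if they agree on test functions. -/
lemma L2w_ext {F : Type*} [NormedAddCommGroup F] [NormedSpace ℂ F] {S T : L2w ν H →L[ℂ] F}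
    (h : ∀ (f : L2w ν H) (g : ℝ → H), f =ᵐ[weight ν] g → HasCompactSupport g → Continuous g →
      S f = T f) : S = T := by
  refine DFunLike.coe_injective (Continuous.ext_on
    (MeasureTheory.Lp.dense_hasCompactSupport_contDiff (F := H) (μ := weight ν) (p := 2) (by simp))
    S.continuous T.continuous ?_)
  rintro f ⟨g, h1, h2, h3⟩
  exact h f g h1 h2 h3.continuous

lemma integrable_exp_smul {f g : ℝ → H} (h : f =ᵐ[weight ν] g) (h1 : HasCompactSupport g)
    (h2 : Continuous g) : Integrable fun t => Real.exp (-ν * t) • f t := by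
  have : Integrable fun t => Real.exp (-ν * t) • g t :=
    ((by fun_prop : Continuous fun t : ℝ => Real.exp (-ν * t)).smul
      h2).integrable_of_hasCompactSupport h1.smul_left
  refine this.congr ?_
  filter_upwards [(ac_weight ν).ae_le h] with t ht
  rw [ht]

lemma integrable_cexp_smul {f : ℝ → H} (hf : Integrable fun t => Real.exp (-ν * t) • f t) (ξ : ℝ) :
    Integrable fun t : ℝ => Complex.exp (-vline ν ξ * t) • f t := by
  have h := hf.bdd_smul 1 (φ := fun t : ℝ => Complex.exp (-(2 * Real.pi * ξ * t : ℝ) * Complex.I))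
    (by fun_prop : Continuous fun t : ℝ =>
      Complex.exp (-(2 * Real.pi * ξ * t : ℝ) * Complex.I)).aestronglyMeasurable
    (ae_of_all _ fun t => by rw [← Complex.ofReal_neg, Complex.norm_exp_ofReal_mul_I])
  refine h.congr (ae_of_all _ fun t => ?_)
  rw [Pi.smul_apply', ← Complex.coe_smul, ← mul_smul, Complex.ofReal_exp, ← Complex.exp_add]
  congr 2
  simp [vline]
  ring

/-- For compactly supported `f` the Laplace integral converges absolutely and `B` passes under it;
density does the rest. -/
lemma laplace_compLpL (B : H →L[ℂ] H) (f : L2w ν H) :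
    laplace ν H (B.compLpL 2 (weight ν) f) = B.compLpL 2 volume (laplace ν H f) := by
  refine DFunLike.congr_fun (L2w_ext
    (S := (laplace ν H).toContinuousLinearEquiv.toContinuousLinearMap ∘L B.compLpL 2 (weight ν))
    (T := B.compLpL 2 volume ∘L (laplace ν H).toContinuousLinearEquiv.toContinuousLinearMap)
    fun f g h1 h2 h3 => ?_) f
  change laplace ν H (B.compLpL 2 (weight ν) f) = B.compLpL 2 volume (laplace ν H f)
  have hB : ∀ᵐ t, B.compLpL 2 (weight ν) f t = B (f t) :=
    (ac_weight ν).ae_le (B.coeFn_compLpL f)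
  have hf := integrable_exp_smul h1 h2 h3
  have hBf : Integrable fun t => Real.exp (-ν * t) • B.compLpL 2 (weight ν) f t :=
    (B.integrable_comp hf).congr (hB.mono fun t ht => by simp [ht])
  refine Lp.ext ((coeFn_laplace _ hBf).trans ?_)
  filter_upwards [B.coeFn_compLpL (p := 2) (laplace ν H f), coeFn_laplace f hf] with ξ h4 h5
  rw [h4, h5, ← B.integral_comp_comm (integrable_cexp_smul hf ξ)]
  refine integral_congr_ae (hB.mono fun t ht => ?_)
  simp only [ht, map_smul]

variable [hν : Fact (0 < ν)]

lemma vline_ne_zero (ξ : ℝ) : vline ν ξ ≠ 0 := fun h => by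
  have := congrArg Complex.re h
  rw [vline_re] at this
  exact hν.out.ne' this

lemma le_norm_vline (ξ : ℝ) : ν ≤ ‖vline ν ξ‖ := by
  simpa using Complex.re_le_norm (vline ν ξ)

lemma integrableOn_Ici_exp (a : ℝ) : IntegrableOn (fun t => Real.exp (-ν * t)) (Ici a) := by
  rw [integrableOn_Ici_iff_integrableOn_Ioi]
  exact integrableOn_exp_mul_Ioi (neg_lt_zero.2 hν.out) a

lemma hasDerivAt_antideriv {g : ℝ → H} (h2 : HasCompactSupport g) (h3 : Continuous g) (t : ℝ) :
    HasDerivAt (antideriv g) (g t) t := by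
  have hi : Integrable g := h3.integrable_of_hasCompactSupport h2
  have e : antideriv g = fun t => (∫ s in Iic (0 : ℝ), g s) + ∫ s in (0 : ℝ)..t, g s := by
    ext t
    rw [← intervalIntegral.integral_Iic_sub_Iic hi.integrableOn hi.integrableOn]
    simp [antideriv]
  rw [e]
  exact (intervalIntegral.integral_hasDerivAt_right hi.intervalIntegrable
    (h3.stronglyMeasurableAtFilter _ _) h3.continuousAt).const_add _

/-- The antiderivative vanishes to the left of the support of `g` and is bounded by `∫ ‖g‖`. It need
not decay at `+∞`, where `ν > 0` makes the weight integrable. -/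
lemma integrable_exp_smul_antideriv {g : ℝ → H} (h2 : HasCompactSupport g) (h3 : Continuous g) :
    Integrable fun t => Real.exp (-ν * t) • antideriv g t := by
  have hi : Integrable g := h3.integrable_of_hasCompactSupport h2
  obtain ⟨a, ha⟩ := h2.bddBelow
  have hc : Continuous (antideriv g) :=
    continuous_iff_continuousAt.2 fun t => (hasDerivAt_antideriv h2 h3 t).continuousAt
  have hdom : IntegrableOn (fun t => (∫ s, ‖g s‖) * Real.exp (-ν * t)) (Ici a) :=
    (integrableOn_Ici_exp a).const_mul _
  refine ((integrable_indicator_iff measurableSet_Ici).2 hdom).mono'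
    (by fun_prop : Continuous _).aestronglyMeasurable (ae_of_all _ fun t => ?_)
  by_cases hta : t ∈ Ici a
  · rw [indicator_of_mem hta, norm_smul, Real.norm_of_nonneg (Real.exp_pos _).le, mul_comm]
    gcongr
    exact (norm_integral_le_integral_norm _).trans
      (setIntegral_le_integral hi.norm (ae_of_all _ fun s => norm_nonneg _))
  · have : antideriv g t = 0 := setIntegral_eq_zero_of_forall_eq_zero fun s hs => by
      by_contra hne
      exact hta ((ha (subset_tsupport _ hne)).trans hs)
    rw [this, indicator_of_notMem hta, smul_zero, norm_zero]

/-- Integration by parts. The antiderivative is in general not compactly supported; the boundary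
terms disappear because the weighted functions are integrable. -/
lemma vline_smul_integral_antideriv {g : ℝ → H} (h2 : HasCompactSupport g) (h3 : Continuous g)
    (ξ : ℝ) : vline ν ξ • ∫ t : ℝ, Complex.exp (-vline ν ξ * t) • antideriv g t
      = ∫ t : ℝ, Complex.exp (-vline ν ξ * t) • g t := by
  have hF := integrable_cexp_smul (integrable_exp_smul_antideriv (ν := ν) h2 h3) ξ
  have hg := integrable_cexp_smul (integrable_exp_smul (ν := ν) (ae_eq_refl g) h2 h3) ξ
  have := integral_bilinear_hasDerivAt_right_eq_neg_left_of_integrable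
    (L := ContinuousLinearMap.lsmul ℝ ℂ (E := H)) (u := fun t : ℝ => Complex.exp (-vline ν ξ * t))
    (u' := fun t : ℝ => -vline ν ξ * Complex.exp (-vline ν ξ * t)) (v := antideriv g) (v' := g)
    (fun t _ => by
      have h := ((hasDerivAt_id (t : ℂ)).const_mul (-vline ν ξ)).cexp.comp_ofReal
      simpa [mul_comm] using h)
    (fun t _ => hasDerivAt_antideriv h2 h3 t) hg
    ((hF.smul (-vline ν ξ)).congr (ae_of_all _ fun t => by simp [mul_smul])) hF
  simp only [ContinuousLinearMap.lsmul_apply] at this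
  rw [this, ← integral_smul, ← integral_neg]
  simp [mul_smul]

lemma continuous_inv_vline : Continuous fun ξ => (vline ν ξ)⁻¹ :=
  (continuous_vline ν).inv₀ vline_ne_zero

/-- The density argument needs a bounded operator on the right as well: `|s| ≥ ν` on the line bounds
multiplication by `s⁻¹` by `ν⁻¹`. -/
lemma coeFn_laplace_timeDerivInv (f : L2w ν H) :
    laplace ν H (timeDerivInv ν f) =ᵐ[volume] fun ξ => (vline ν ξ)⁻¹ • laplace ν H f ξ := by
  have hM : Continuous fun ξ => (vline ν ξ)⁻¹ • ContinuousLinearMap.id ℂ H :=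
    continuous_inv_vline.smul continuous_const
  have hC : ∀ ξ, ‖(vline ν ξ)⁻¹ • ContinuousLinearMap.id ℂ H‖ ≤ ν⁻¹ := fun ξ => by
    rw [norm_smul, norm_inv]
    exact (mul_le_of_le_one_right (by positivity) ContinuousLinearMap.norm_id_le).trans
      (inv_anti₀ hν.out (le_norm_vline ξ))
  have h : laplace ν H (timeDerivInv ν f) = mulOp _ hM _ hC (laplace ν H f) := by
    refine DFunLike.congr_fun (L2w_ext
      (S := (laplace ν H).toContinuousLinearEquiv.toContinuousLinearMap ∘L timeDerivInv ν)
      (T := mulOp _ hM _ hC ∘L (laplace ν H).toContinuousLinearEquiv.toContinuousLinearMap)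
      fun f g h1 h2 h3 => ?_) f
    change laplace ν H (timeDerivInv ν f) = mulOp _ hM _ hC (laplace ν H f)
    have hD : ∀ᵐ t, timeDerivInv ν f t = antideriv g t := by
      rw [← antideriv_congr h1]
      exact (ac_weight ν).ae_le (coeFn_timeDerivInv f)
    have hi : Integrable fun t => Real.exp (-ν * t) • timeDerivInv ν f t :=
      (integrable_exp_smul_antideriv (ν := ν) h2 h3).congr (hD.mono fun t ht => by simp only [ht])
    refine Lp.ext ((coeFn_laplace _ hi).trans ?_)
    filter_upwards [coeFn_mulOp hM hC (laplace ν H f),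
      coeFn_laplace f (integrable_exp_smul h1 h2 h3)] with ξ h4 h5
    rw [h4, smul_apply, ContinuousLinearMap.id_apply, h5, eq_inv_smul_iff₀ (vline_ne_zero ξ)]
    have e1 : ∫ t : ℝ, Complex.exp (-vline ν ξ * t) • timeDerivInv ν f t
        = ∫ t : ℝ, Complex.exp (-vline ν ξ * t) • antideriv g t :=
      integral_congr_ae (hD.mono fun t ht => by simp only [ht])
    have e2 : ∫ t : ℝ, Complex.exp (-vline ν ξ * t) • f t
        = ∫ t : ℝ, Complex.exp (-vline ν ξ * t) • g t :=
      integral_congr_ae (((ac_weight ν).ae_eq h1).mono fun t ht => by simp only [ht])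
    rw [e1, e2, vline_smul_integral_antideriv h2 h3]
  rw [h]
  filter_upwards [coeFn_mulOp hM hC (laplace ν H f)] with ξ hξ
  rw [hξ, smul_apply, ContinuousLinearMap.id_apply]

lemma coeFn_laplace_timeDerivInv_pow (f : L2w ν H) (k : ℕ) :
    laplace ν H ((timeDerivInv ν ^ k) f)
      =ᵐ[volume] fun ξ => ((vline ν ξ)⁻¹) ^ k • laplace ν H f ξ := by
  induction k with
  | zero => exact Eventually.of_forall fun ξ => by simp
  | succ k ih =>
    rw [pow_succ', mul_apply_eq_comp]
    filter_upwards [ih, coeFn_laplace_timeDerivInv ((timeDerivInv ν ^ k) f)] with ξ h1 h2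
    rw [h2, h1, pow_succ', mul_smul]

lemma coeFn_laplace_step (x : H) :
    laplace ν H (step ν x) =ᵐ[volume] fun ξ => (vline ν ξ)⁻¹ • x := by
  have hs : step ν x =ᵐ[volume] (Ici 0).indicator fun _ => x :=
    (ac_weight ν).ae_le indicatorConstLp_coeFn
  have hi : Integrable fun t => Real.exp (-ν * t) • step ν x t := by
    have h1 : IntegrableOn (fun t => Real.exp (-ν * t) • x) (Ici 0) :=
      (integrableOn_Ici_exp 0).smul_const x
    refine ((integrable_indicator_iff measurableSet_Ici).2 h1).congr (hs.mono fun t ht => ?_)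
    simp only [ht]
    by_cases h0 : t ∈ Ici (0 : ℝ) <;> simp [h0, indicator]
  refine (coeFn_laplace _ hi).trans (Eventually.of_forall fun ξ => ?_)
  have h2 : ∀ᵐ t : ℝ, Complex.exp (-vline ν ξ * t) • step ν x t
      = (Ici 0).indicator (fun t : ℝ => Complex.exp (-vline ν ξ * t) • x) t := by
    filter_upwards [hs] with t ht
    rw [ht]
    by_cases h0 : t ∈ Ici (0 : ℝ) <;> simp [h0, indicator]
  simp only
  rw [integral_congr_ae h2, integral_indicator measurableSet_Ici, integral_smul_const,
    integral_Ici_eq_integral_Ioi, integral_exp_mul_complex_Ioi (by simpa using hν.out)]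
  simp [neg_div_neg_eq]

end

section

variable {H : Type*} [NormedAddCommGroup H] [InnerProductSpace ℂ H] [CompleteSpace H]

/-! ### The resolvent on the closed half-plane -/

variable {E A : H →L[ℂ] H} {ν : ℝ}

/-- Regularity concerns the open half-plane, while the symbol lives on its boundary line. The
resolvent bound stays finite near a boundary point, so a Neumann series around a point slightly to
the right reaches it. -/
lemma isUnit_pencil_of_le_re (hU : {s : ℂ | ν < s.re} ⊆ resolventSet E A) {k : ℕ} {C : ℝ}
    (hC0 : 0 ≤ C) (hC : ∀ s : ℂ, ν < s.re → ‖Ring.inverse (s • E + A)‖ ≤ C * ‖s‖ ^ k)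
    {s : ℂ} (hs : ν ≤ s.re) : IsUnit (s • E + A) := by
  -- A bound for the inverse at every `s + δ` with `0 < δ ≤ 1`; the summand `1` gives `1 ≤ M`, hence
  -- `δ ≤ 1` below.
  set M : ℝ := C * (‖s‖ + 1) ^ k + 1
  have hM : 1 ≤ M := le_add_of_nonneg_left (by positivity)
  -- Chosen so that `M δ ‖E‖ < 1`; replacing `‖E‖` by `‖E‖ + 1` makes the inequality strict and
  -- covers `E = 0`.
  set δ : ℝ := (M * (‖E‖ + 1))⁻¹
  have hδ : 0 < δ := by positivity
  have hδ1 : δ ≤ 1 := inv_le_one_of_one_le₀ (one_le_mul_of_one_le_of_one_le hM (by simp))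
  have hre : ν < (s + δ).re := by simpa using by linarith
  obtain ⟨u, hu⟩ : IsUnit ((s + δ) • E + A) := hU hre
  have hinv : ‖(↑u⁻¹ : H →L[ℂ] H)‖ ≤ M := by
    have h := hC _ hre
    rw [← hu, Ring.inverse_unit] at h
    refine h.trans ?_
    have : ‖s + δ‖ ≤ ‖s‖ + 1 := (norm_add_le _ _).trans (by
      rw [Complex.norm_real, Real.norm_of_nonneg hδ.le]; linarith)
    calc C * ‖s + δ‖ ^ k ≤ C * (‖s‖ + 1) ^ k := by gcongr
      _ ≤ M := by simp [M]
  have hsmall : ‖(↑u⁻¹ : H →L[ℂ] H) * ((δ : ℂ) • E)‖ < 1 := by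
    refine (norm_mul_le _ _).trans_lt ?_
    rw [norm_smul, Complex.norm_real, Real.norm_of_nonneg hδ.le]
    calc _ ≤ M * (δ * ‖E‖) := by gcongr
      _ < M * (δ * (‖E‖ + 1)) := by gcongr; simp
      _ = 1 := by simp only [δ]; field_simp
  have : s • E + A = u * (1 - (↑u⁻¹ : H →L[ℂ] H) * ((δ : ℂ) • E)) := by
    rw [mul_sub, Units.mul_inv_cancel_left, mul_one, hu, add_smul]
    abel
  rw [this]
  exact u.isUnit.mul (isUnit_one_sub_of_norm_lt_one hsmall)

lemma differentiableAt_inverse_pencil {s : ℂ} (h : IsUnit (s • E + A)) :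
    DifferentiableAt ℂ (fun s : ℂ => Ring.inverse (s • E + A)) s :=
  (differentiableAt_inverse h).comp (𝕜 := ℂ) s (f := fun s : ℂ => s • E + A) (by fun_prop)

/-- The bound passes to the boundary line by continuity of the resolvent, letting `s + δ` tend to
`s` from the right. -/
lemma norm_inverse_pencil_le (hU : ∀ s : ℂ, ν ≤ s.re → IsUnit (s • E + A)) {k : ℕ} {C : ℝ}
    (hC : ∀ s : ℂ, ν < s.re → ‖Ring.inverse (s • E + A)‖ ≤ C * ‖s‖ ^ k)
    {s : ℂ} (hs : ν ≤ s.re) : ‖Ring.inverse (s • E + A)‖ ≤ C * ‖s‖ ^ k := by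
  have ht : Tendsto (fun δ : ℝ => s + δ) (𝓝[>] 0) (𝓝 s) := by
    have : Continuous fun δ : ℝ => s + (δ : ℂ) := by fun_prop
    simpa using (this.tendsto 0).mono_left nhdsWithin_le_nhds
  refine le_of_tendsto_of_tendsto
    ((differentiableAt_inverse_pencil (hU s hs)).continuousAt.norm.tendsto.comp ht)
    (((by fun_prop : Continuous fun s : ℂ => C * ‖s‖ ^ k).tendsto s).comp ht) ?_
  filter_upwards [self_mem_nhdsWithin] with δ hδ
  have hδ' : (0 : ℝ) < δ := hδ
  exact hC _ (by simpa using by linarith)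

/-! ### Integrals along vertical lines -/

variable [hν : Fact (0 < ν)]

lemma integrable_of_norm_le_norm_sq {Ψ : ℂ → H} {K : ℝ}
    (hd : ∀ s : ℂ, ν ≤ s.re → DifferentiableAt ℂ Ψ s)
    (hK : ∀ s : ℂ, ν ≤ s.re → ‖Ψ s‖ ≤ K * (‖s‖ ^ 2)⁻¹) :
    Integrable fun y : ℝ => Ψ (ν + y * Complex.I) := by
  have hpos := hν.out
  have hre : ∀ y : ℝ, ν ≤ (ν + y * Complex.I : ℂ).re := fun y => by simp
  have hK0 : 0 ≤ K := by
    have h := (norm_nonneg _).trans (hK ν (by simp))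
    exact nonneg_of_mul_nonneg_left h (by simpa using pow_pos hpos 2)
  have hc : Continuous fun y : ℝ => Ψ (ν + y * Complex.I) := continuous_iff_continuousAt.2 fun y =>
    ContinuousAt.comp (f := fun y : ℝ => (ν + y * Complex.I : ℂ)) (hd _ (hre y)).continuousAt
      (by fun_prop)
  -- `|s|² = ν² + y² ≥ c (1 + y²)`, which gives the integrable majorant `K c⁻¹ / (1 + y²)`.
  set c : ℝ := min (ν ^ 2) 1
  have hc0 : 0 < c := lt_min (by positivity) one_pos
  refine (integrable_inv_one_add_sq.const_mul (K * c⁻¹)).mono' hc.aestronglyMeasurable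
    (ae_of_all _ fun y => (hK _ (hre y)).trans ?_)
  rw [mul_assoc, ← mul_inv]
  have hn : ‖(ν + y * Complex.I : ℂ)‖ ^ 2 = ν ^ 2 + y ^ 2 := by
    rw [← Complex.normSq_eq_norm_sq, Complex.normSq_add_mul_I]
  rw [hn]
  gcongr
  nlinarith [min_le_left (ν ^ 2) 1, min_le_right (ν ^ 2) 1, sq_nonneg y]

/-- A function that is holomorphic and `O(|s|⁻²)` on a closed half-plane has integral zero along
the boundary. -/
lemma integral_eq_zero_of_norm_le_norm_sq {Ψ : ℂ → H} {K : ℝ}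
    (hd : ∀ s : ℂ, ν ≤ s.re → DifferentiableAt ℂ Ψ s)
    (hK : ∀ s : ℂ, ν ≤ s.re → ‖Ψ s‖ ≤ K * (‖s‖ ^ 2)⁻¹) :
    ∫ y : ℝ, Ψ (ν + y * Complex.I) = 0 := by
  have hK0 : 0 ≤ K := by
    have h := (norm_nonneg _).trans (hK ν (by simp))
    have hpos := hν.out
    exact nonneg_of_mul_nonneg_left h (by simpa using pow_pos hpos 2)
  -- Cauchy's theorem on the rectangle `[ν, ν + R] × [-R, R]`. On the other three sides `|s| ≥ R`,
  -- and their total length is `4R`, whence `4R · K R⁻²`.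
  have hbound : ∀ R : ℝ, 0 < R → ‖∫ y in -R..R, Ψ (ν + y * Complex.I)‖ ≤ 4 * K * R⁻¹ := by
    intro R hR
    have hrect := Complex.integral_boundary_rect_eq_zero_of_differentiableOn Ψ
      (⟨ν, -R⟩ : ℂ) (⟨ν + R, R⟩ : ℂ) fun s hs => by
        have h1 := hs.1
        simp only [mem_preimage, uIcc_of_le (by linarith : ν ≤ ν + R)] at h1
        exact (hd s h1.1).differentiableWithinAt
    simp only at hrect
    have hb : ∀ s : ℂ, ν ≤ s.re → R ≤ ‖s‖ → ‖Ψ s‖ ≤ K * (R ^ 2)⁻¹ := fun s h1 h2 =>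
      (hK s h1).trans (by gcongr)
    have b1 : ‖∫ x in ν..(ν + R), Ψ (x + (-R : ℝ) * Complex.I)‖ ≤ K * (R ^ 2)⁻¹ * R := by
      have := intervalIntegral.norm_integral_le_of_norm_le_const (a := ν) (b := ν + R)
        (f := fun x : ℝ => Ψ (x + (-R : ℝ) * Complex.I)) (C := K * (R ^ 2)⁻¹) fun x hx => by
          rw [uIoc_of_le (by linarith)] at hx
          refine hb _ (by simpa using hx.1.le) ?_
          simpa [abs_of_pos hR] using Complex.abs_im_le_norm (x + (-R : ℝ) * Complex.I)
      simpa [abs_of_pos hR] using this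
    have b2 : ‖∫ x in ν..(ν + R), Ψ (x + R * Complex.I)‖ ≤ K * (R ^ 2)⁻¹ * R := by
      have := intervalIntegral.norm_integral_le_of_norm_le_const (a := ν) (b := ν + R)
        (f := fun x : ℝ => Ψ (x + R * Complex.I)) (C := K * (R ^ 2)⁻¹) fun x hx => by
          rw [uIoc_of_le (by linarith)] at hx
          refine hb _ (by simpa using hx.1.le) ?_
          simpa [abs_of_pos hR] using Complex.abs_im_le_norm (x + R * Complex.I)
      simpa [abs_of_pos hR] using this
    have b3 : ‖∫ y in -R..R, Ψ ((ν + R : ℝ) + y * Complex.I)‖ ≤ K * (R ^ 2)⁻¹ * (2 * R) := by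
      have := intervalIntegral.norm_integral_le_of_norm_le_const (a := -R) (b := R)
        (f := fun y : ℝ => Ψ ((ν + R : ℝ) + y * Complex.I)) (C := K * (R ^ 2)⁻¹) fun y _ => by
          refine hb _ (by simpa using hR.le) ?_
          have h := Complex.re_le_norm ((ν + R : ℝ) + y * Complex.I)
          simp only [Complex.add_re, Complex.ofReal_re, Complex.mul_re, Complex.I_re, mul_zero,
            Complex.ofReal_im, Complex.I_im, mul_one, sub_self, add_zero] at h
          linarith [hν.out]
      rwa [show R - -R = 2 * R by ring, abs_of_pos (by positivity)] at this
    have e : Complex.I • (∫ y in -R..R, Ψ (ν + y * Complex.I))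
        = (∫ x in ν..(ν + R), Ψ (x + (-R : ℝ) * Complex.I))
          - (∫ x in ν..(ν + R), Ψ (x + R * Complex.I))
          + Complex.I • ∫ y in -R..R, Ψ ((ν + R : ℝ) + y * Complex.I) :=
      (sub_eq_zero.1 hrect).symm
    have hn := congrArg norm e
    rw [norm_smul, Complex.norm_I, one_mul] at hn
    rw [hn]
    have b4 : ‖Complex.I • ∫ y in -R..R, Ψ ((ν + R : ℝ) + y * Complex.I)‖
        ≤ K * (R ^ 2)⁻¹ * (2 * R) := by
      rwa [norm_smul, Complex.norm_I, one_mul]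
    refine (norm_add_le_of_le (norm_sub_le_of_le b1 b2) b4).trans_eq ?_
    field_simp
    ring
  have hlim := intervalIntegral_tendsto_integral (integrable_of_norm_le_norm_sq hd hK)
    tendsto_neg_atTop_atBot tendsto_id
  refine tendsto_nhds_unique hlim (squeeze_zero_norm' (a := fun R : ℝ => 4 * K * R⁻¹) ?_ ?_)
  · filter_upwards [eventually_gt_atTop 0] with R hR using hbound R hR
  · simpa using tendsto_inv_atTop_zero.const_mul (4 * K)

lemma integrable_vline_of_norm_le_norm_sq {Ψ : ℂ → H} {K : ℝ}
    (hd : ∀ s : ℂ, ν ≤ s.re → DifferentiableAt ℂ Ψ s)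
    (hK : ∀ s : ℂ, ν ≤ s.re → ‖Ψ s‖ ≤ K * (‖s‖ ^ 2)⁻¹) : Integrable fun ξ => Ψ (vline ν ξ) :=
  (integrable_of_norm_le_norm_sq hd hK).comp_mul_left' Real.two_pi_pos.ne'

/-- For `t ≤ 0` one has `|exp (s t)| ≤ 1` on the half-plane, so the exponential does not spoil the
decay and the contour closes to the right. -/
lemma integral_vline_eq_zero {Φ : ℂ → H} {K : ℝ}
    (hd : ∀ s : ℂ, ν ≤ s.re → DifferentiableAt ℂ Φ s)
    (hK : ∀ s : ℂ, ν ≤ s.re → ‖Φ s‖ ≤ K * (‖s‖ ^ 2)⁻¹) {t : ℝ} (ht : t ≤ 0) :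
    ∫ ξ, Complex.exp (vline ν ξ * t) • Φ (vline ν ξ) = 0 := by
  have h := integral_eq_zero_of_norm_le_norm_sq (ν := ν) (K := K)
    (Ψ := fun s => Complex.exp (s * t) • Φ s)
    (fun s hs => DifferentiableAt.smul (by fun_prop) (hd s hs)) fun s hs => by
      rw [norm_smul, Complex.norm_exp]
      refine (mul_le_of_le_one_left (norm_nonneg _) (Real.exp_le_one_iff.2 ?_)).trans (hK s hs)
      simpa using mul_nonpos_of_nonneg_of_nonpos (hν.out.le.trans hs) ht
  -- Substitution `y = 2πξ`.
  have h2 := Measure.integral_comp_mul_left (fun y : ℝ =>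
    Complex.exp ((ν + y * Complex.I) * t) • Φ (ν + y * Complex.I)) (2 * Real.pi)
  rw [h, smul_zero] at h2
  exact h2

/-- If the antiderivative of `g` vanishes on the negative half-line, so does `g`. -/
lemma ae_eq_zero_of_timeDerivInv {g : L2w ν H} (h : ∀ᵐ t : ℝ, t < 0 → timeDerivInv ν g t = 0) :
    ∀ᵐ t : ℝ, t < 0 → g t = 0 := by
  refine isOpen_Iio.ae_eq_zero_of_integral_contDiff_smul_eq_zero (U := Iio (0 : ℝ))
    ((locallyIntegrable hν.out g).locallyIntegrableOn _) fun φ h1 h2 h3 => ?_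
  have hw := isWeakDeriv_antideriv hν.out g φ h1 h2
  rw [← neg_inj, ← hw, neg_zero]
  refine integral_eq_zero_of_ae ?_
  filter_upwards [h, (ac_weight ν).ae_le (coeFn_timeDerivInv g)] with t ht1 ht2
  -- The support of `φ` lies in the open negative half-line, where the antiderivative vanishes;
  -- elsewhere `φ' = 0`.
  by_cases ht : t ∈ tsupport φ
  · rw [← ht2, ht1 (h3 ht), smul_zero, Pi.zero_apply]
  · have : deriv φ t = 0 := by
      by_contra hne
      exact ht (support_deriv_subset hne)
    rw [this, zero_smul, Pi.zero_apply]

/-! ### The solution operator -/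

lemma coeFn_laplace_boundedPencil (f : L2w ν H) :
    laplace ν H (boundedPencil ν E A f)
      =ᵐ[volume] fun ξ => (vline ν ξ)⁻¹ • (vline ν ξ • E + A) (laplace ν H f ξ) := by
  rw [boundedPencil, add_apply, map_add, laplace_compLpL, ContinuousLinearMap.comp_apply]
  filter_upwards [Lp.coeFn_add (E.compLpL 2 volume (laplace ν H f))
      (laplace ν H (timeDerivInv ν (A.compLpL 2 (weight ν) f))),
    E.coeFn_compLpL (p := 2) (laplace ν H f),
    coeFn_laplace_timeDerivInv (A.compLpL 2 (weight ν) f),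
    A.coeFn_compLpL (p := 2) (laplace ν H f)] with ξ h1 h2 h3 h4
  rw [h1, Pi.add_apply, h2, h3, laplace_compLpL, h4, add_apply, smul_apply, smul_add,
    inv_smul_smul₀ (vline_ne_zero ξ)]

/-- `T` is multiplication by `s^{-k} (sE + A)⁻¹` on the transform side. Its product in either order
with the symbol `s⁻¹ (sE + A)` is `s^{-(k+1)}`. -/
lemma exists_bounded_solution_operator {k : ℕ} {C : ℝ}
    (hU : ∀ s : ℂ, ν ≤ s.re → IsUnit (s • E + A))
    (hC : ∀ s : ℂ, ν ≤ s.re → ‖Ring.inverse (s • E + A)‖ ≤ C * ‖s‖ ^ k) :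
    ∃ T : L2w ν H →L[ℂ] L2w ν H,
      (∀ f, boundedPencil ν E A (T f) = (timeDerivInv ν ^ (k + 1)) f) ∧
      (∀ f, T (boundedPencil ν E A f) = (timeDerivInv ν ^ (k + 1)) f) ∧
      ∀ x, ∀ᵐ t : ℝ, t < 0 → T (step ν x) t = 0 := by
  have hre : ∀ ξ, ν ≤ (vline ν ξ).re := fun ξ => (vline_re ν ξ).ge
  have hne : ∀ s : ℂ, ν ≤ s.re → s ≠ 0 := fun s hs h => by
    rw [h, Complex.zero_re] at hs
    exact hs.not_gt hν.out
  -- The `n` powers of `s⁻¹` beyond `k` measure decay: `n = 0` gives boundedness of `T`, `n = 2` the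
  -- decay for the contour argument.
  have hR : ∀ s : ℂ, ν ≤ s.re → ∀ n,
      ‖(s⁻¹) ^ (k + n) • Ring.inverse (s • E + A)‖ ≤ C * (‖s‖ ^ n)⁻¹ := fun s hs n => by
    have := norm_pos_iff.2 (hne s hs)
    rw [norm_smul, norm_pow, norm_inv]
    calc _ ≤ (‖s‖⁻¹) ^ (k + n) * (C * ‖s‖ ^ k) := by gcongr; exact hC s hs
      _ = _ := by rw [pow_add, inv_pow, inv_pow]; field_simp
  have hM : Continuous fun ξ => (vline ν ξ)⁻¹ ^ k • Ring.inverse (vline ν ξ • E + A) :=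
    (continuous_inv_vline.pow k).smul (continuous_iff_continuousAt.2 fun ξ =>
      ContinuousAt.comp (f := vline ν) (g := fun s : ℂ => Ring.inverse (s • E + A))
        (differentiableAt_inverse_pencil (hU _ (hre ξ))).continuousAt
        (continuous_vline ν).continuousAt)
  have hMC : ∀ ξ, ‖(vline ν ξ)⁻¹ ^ k • Ring.inverse (vline ν ξ • E + A)‖ ≤ C := fun ξ => by
    simpa using hR _ (hre ξ) 0
  let T : L2w ν H →L[ℂ] L2w ν H :=
    (laplace ν H).symm.toContinuousLinearEquiv.toContinuousLinearMap ∘L mulOp _ hM C hMC ∘L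
      (laplace ν H).toContinuousLinearEquiv.toContinuousLinearMap
  have hT : ∀ f, laplace ν H (T f) =ᵐ[volume] fun ξ =>
      (vline ν ξ)⁻¹ ^ k • Ring.inverse (vline ν ξ • E + A) (laplace ν H f ξ) := fun f => by
    have : laplace ν H (T f) = mulOp _ hM C hMC (laplace ν H f) :=
      (laplace ν H).apply_symm_apply _
    rw [this]
    exact coeFn_mulOp hM hMC _
  refine ⟨T, fun f => (laplace ν H).injective (Lp.ext ?_),
    fun f => (laplace ν H).injective (Lp.ext ?_), fun x => ae_eq_zero_of_timeDerivInv ?_⟩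
  · filter_upwards [hT f, coeFn_laplace_boundedPencil (E := E) (A := A) (T f),
      coeFn_laplace_timeDerivInv_pow f (k + 1)] with ξ h1 h2 h3
    rw [h2, h1, h3, map_smul, ← mul_apply_eq_comp, Ring.mul_inverse_cancel _ (hU _ (hre ξ)),
      one_apply_eq_self, ← mul_smul, pow_succ']
  · filter_upwards [hT (boundedPencil ν E A f), coeFn_laplace_boundedPencil (E := E) (A := A) f,
      coeFn_laplace_timeDerivInv_pow f (k + 1)] with ξ h1 h2 h3
    rw [h1, h2, h3, map_smul, ← mul_apply_eq_comp, Ring.inverse_mul_cancel _ (hU _ (hre ξ)),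
      one_apply_eq_self, ← mul_smul, pow_succ]
  -- Beyond the `k` powers in `T`, one `s⁻¹` comes from the step and one from the additional `∂⁻¹`.
  -- Without the latter only `O(|s|⁻¹)` would be guaranteed, which does not ensure integrability.
  · set Φ : ℂ → H := fun s => ((s⁻¹) ^ (k + 2) • Ring.inverse (s • E + A)) x
    have hd : ∀ s : ℂ, ν ≤ s.re → DifferentiableAt ℂ Φ s := fun s hs =>
      (((differentiableAt_inv (hne s hs)).pow _).smul
        (differentiableAt_inverse_pencil (hU s hs))).clm_apply (differentiableAt_const x)
    have hK : ∀ s : ℂ, ν ≤ s.re → ‖Φ s‖ ≤ C * ‖x‖ * (‖s‖ ^ 2)⁻¹ := fun s hs =>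
      (ContinuousLinearMap.le_of_opNorm_le _ (hR s hs 2) x).trans_eq (by ring)
    have hL : laplace ν H (timeDerivInv ν (T (step ν x))) =ᵐ[volume] fun ξ => Φ (vline ν ξ) := by
      filter_upwards [coeFn_laplace_timeDerivInv (T (step ν x)), hT (step ν x),
        coeFn_laplace_step (ν := ν) x] with ξ h1 h2 h3
      rw [h1, h2, h3, map_smul]
      simp only [Φ, smul_apply, ← mul_smul]
      congr 1
      ring
    filter_upwards [ae_eq_of_laplace_ae_eq _ (integrable_vline_of_norm_le_norm_sq hd hK) hL]
      with t h1 h2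
    rw [h1, integral_vline_eq_zero hd hK h2.le]

end

/-! ### Change of the exponent and of the half-plane -/

/-- On the half-plane `|s| ≥ ν > 0`, so each additional power of `|s|` costs a factor `ν⁻¹` in the
constant. -/
lemma HasResolventBound.mono {H : Type*} [NormedAddCommGroup H] [InnerProductSpace ℂ H]
    {E A : H →L[ℂ] H} {ν : ℝ} (hν : 0 < ν) {k l : ℕ} (hkl : k ≤ l)
    (h : HasResolventBound E A ν k) : HasResolventBound E A ν l := by
  obtain ⟨C, hC0, hC⟩ := h
  refine ⟨C * (ν⁻¹) ^ (l - k), by positivity, fun s hs => (hC s hs).trans ?_⟩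
  have hs' : ν ≤ ‖s‖ := hs.le.trans (Complex.re_le_norm s)
  obtain ⟨m, rfl⟩ := Nat.exists_eq_add_of_le hkl
  rw [Nat.add_sub_cancel_left, pow_add, mul_assoc]
  gcongr
  calc ‖s‖ ^ k = (ν⁻¹ * ν) ^ m * ‖s‖ ^ k := by rw [inv_mul_cancel₀ hν.ne', one_pow, one_mul]
    _ ≤ (ν⁻¹ * ‖s‖) ^ m * ‖s‖ ^ k := by gcongr
    _ = _ := by ring

lemma IsRegularAt.hasResolventBound {H : Type*} [NormedAddCommGroup H] [InnerProductSpace ℂ H]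
    {E A : H →L[ℂ] H} {ν : ℝ} (hν : 0 < ν) (h : IsRegularAt E A ν) {k : ℕ}
    (hk : index E A ν ≤ k) : HasResolventBound E A ν k :=
  -- Regularity makes the set of admissible exponents nonempty, so its infimum in `ℕ` is attained.
  HasResolventBound.mono hν hk (Nat.sInf_mem (s := {k | HasResolventBound E A ν k}) h.2)

lemma IsRegularAt.mono {H : Type*} [NormedAddCommGroup H] [InnerProductSpace ℂ H]
    {E A : H →L[ℂ] H} {ν μ : ℝ} (h : IsRegularAt E A ν) (hνμ : ν ≤ μ) : IsRegularAt E A μ := by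
  obtain ⟨h1, k, C, hC0, hC⟩ := h
  exact ⟨fun s hs => h1 (hνμ.trans_lt hs), k, C, hC0, fun s hs => hC s (hνμ.trans_lt hs)⟩

end DAE
end

theorem theorem2p5 {H : Type*} [NormedAddCommGroup H] [InnerProductSpace ℂ H] [CompleteSpace H]
    (E A : H →L[ℂ] H) (hreg : DAE.IsRegular E A) :
    (∃ ν₀ : ℝ, 0 < ν₀ ∧ ∀ ν : ℝ, ν₀ ≤ ν → DAE.IsRegularAt E A ν) ∧
    ∀ (ν : ℝ) [Fact (0 < ν)], DAE.IsRegularAt E A ν → ∀ k : ℕ, DAE.index E A ν ≤ k →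
      -- `S` is the solution operator `(∂_{0,ν} E + A)⁻¹ : L_{2,ν}(ℝ; H) → H_ν^{-k}(ℝ; H)`
      ∃ S : DAE.L2w ν H →L[ℂ] DAE.Extrap ν k H,
        (∀ (f : DAE.L2w ν H) (w : DAE.Extrap ν k H),
          DAE.pencil ν k E A w = DAE.toExtrap ν (k + 1) f ↔ w = S f) ∧
        ∀ u₀ : H,
          (∃! u : DAE.Extrap ν k H,
            DAE.pencil ν k E A u
              = DAE.inclusion ν (Nat.le_add_left 1 k) (DAE.diracMul ν (E u₀))) ∧
          ∀ u : DAE.Extrap ν k H,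
            DAE.pencil ν k E A u
              = DAE.inclusion ν (Nat.le_add_left 1 k) (DAE.diracMul ν (E u₀)) →
            u = DAE.toExtrap ν k (DAE.step ν u₀) - S (DAE.step ν (A u₀)) ∧
            ∀ᵐ t : ℝ, t < 0 → DAE.timeDerivInvPowExt ν k u t = 0 := by
  refine ⟨?_, fun ν hν hr k hk => ?_⟩
  · obtain ⟨ν, h⟩ := hreg
    -- The number given by regularity may be negative, hence the maximum with `1`.
    exact ⟨max ν 1, lt_max_of_lt_right one_pos, fun μ hμ => h.mono ((le_max_left _ _).trans hμ)⟩
  · obtain ⟨C, hC0, hC⟩ := hr.hasResolventBound hν.out hk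
    have hU : ∀ s : ℂ, ν ≤ s.re → IsUnit (s • E + A) := fun s hs =>
      DAE.isUnit_pencil_of_le_re hr.1 hC0 hC hs
    obtain ⟨T, h1, h2, h3⟩ := DAE.exists_bounded_solution_operator hU
      fun s hs => DAE.norm_inverse_pencil_le hU hC hs
    exact DAE.exists_solution_operator T h1 h2 h3
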